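/- Let $n\ge r$ be integers, $p,q\ge 0$, let $a_1,\dots,a_p,b_1,\dots,b_q\in\mathbb C$, and let $X=\mathrm{diag}(x_1,\dots,x_n)$, $Y=\mathrm{diag}(y_1,\dots,y_n)$ with real or complex entries. For $\alpha=1$ the hypergeometric function of two matrix arguments is $$ {}_pF_q^{(1)}(a_{1:p};b_{1:q};X,Y)=\sum_{k=0}^\infty\frac1{k!}\sum_{\kappa\vdash k,\ \ell(\kappa)\le n}\frac{(a_1)_\kappa\cdots(a_p)_\kappa}{(b_1)_\kappa\cdots(b_q)_\kappa}\,\frac{C_\kappa(X)\,C_\kappa(Y)}{C_\kappa(I_n)},\qquad (c)_\kappa=\prod_{i}\frac{\Gamma(c-i+1+\kappa_i)}{\Gamma(c-i+1)}, $$ where $C_\kappa$ is the $C$-normalized Jack polynomial with $\alpha=1$ (complex zonal polynomial) in $n$ variables, $C_\kappa(x)=k!\,\frac{\prod_{i<j}(\kappa_i-\kappa_j-i+j)}{\prod_j(n+\kappa_j-j)!}\,s_\kappa(x)$ with $s_\kappa$ the Schur polynomial, so that $\sum_{\kappa\vdash k}C_\kappa(x)=(x_1+\dots+x_n)^k$.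 The scalar function is ${}_pF_q(a_{1:p};b_{1:q};z)=\sum_{k\ge0}\frac{(a_1)_k\cdots(a_p)_k}{(b_1)_k\cdots(b_q)_k}\frac{z^k}{k!}$. Quotients of factorials (Gamma functions) whose arguments differ by an integer are read as rising factorials, $\frac{(c-n+j)!}{(c-n)!}=(c-n+1)_j$. Let $k_1,\dots,k_M\ge1$ with $k_1+\dots+k_M=r$, let $\tilde x_1,\dots,\tilde x_M$ be distinct and nonzero, and suppose that $x_1=\dots=x_{k_1}=\tilde x_1$, $x_{k_1+1}=\dots=x_{k_1+k_2}=\tilde x_2$, and so on up to $x_r=\tilde x_M$, while $x_j=0$ for $r<j\le n$. Suppose that no $b_i$ equals $(j-1)-m$ with $1\le j\le n$ and an integer $m\ge 0$, and that no $a_i$ lies in $\{1,\dots,n-1\}$ (so that no denominator below vanishes). Let $\mathrm C$ be a closed contour that winds once counter-clockwise around each of $y_1,\dots,y_n$. Suppose that the series involved converge, in that $p\le q$; or some $a_i\in\{0,-1,-2,\dots\}$ (the series terminate); or $p=q+1$, $\max_j|x_j|\max_s|y_s|<1$ and $|x_jz|<1$ for all $j$ and all $z\in\mathrm C$. Then the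 series for ${}_pF_q^{(1)}$ converges and $$ {}_pF_q^{(1)}(a_{1:p};b_{1:q};X,Y)=\frac{K(a_{1:p},b_{1:q})}{\prod_{1\le i<j\le M}(\tilde x_i-\tilde x_j)^{k_ik_j}}\ \prod_{\ell=1}^M\frac{K_{k_\ell}(a_{1:p},b_{1:q})}{\tilde x_\ell^{\,k_\ell(n-r)}}\ \det(\mathbf A), $$ where $$ K(a_{1:p},b_{1:q})=\prod_{\ell=1}^r\Big[(n-\ell)!\prod_{i=1}^q\frac{(b_i-\ell)!}{(b_i-n)!}\prod_{j=1}^p\frac{(a_j-n)!}{(a_j-\ell)!}\Big], $$ $$ K_{k}(a_{1:p},b_{1:q})=\prod_{j=1}^{k-1}\Big[\frac1{(k-j)!}\,\frac{\prod_{i=1}^p(a_i-n+j)!/(a_i-n)!}{\prod_{i=1}^q(b_i-n+j)!/(b_i-n)!}\Big] $$ (equal to $1$ for $k=1$), and $\mathbf A$ is the $r\times r$ matrix whose row blocks, from top to bottom, are the $k_\ell\times r$ matrices $\mathbf A_\ell$, $1\le\ell\le M$, with entries $$ (\mathbf A_\ell)_{i,j}=\frac1{2\pi\iota}\oint_{\mathrm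 C}\frac{{}_pF_q(a_{1:p}-n+1+k_\ell-i;\ b_{1:q}-n+1+k_\ell-i;\ \tilde x_\ell z)\;z^{k_\ell-i+j-1}}{\prod_{s=1}^n(z-y_s)}\,dz . $$ -/

import Mathlib

open scoped Nat

noncomputable section

namespace MatrixHypergeometric

/-! ### Complex zonal polynomials -/

/-- The partitions of `k` with at most `n` parts, written as weakly decreasing vectors
`κ = (κ₁ ≥ κ₂ ≥ ⋯ ≥ κₙ ≥ 0)` padded with zeros. -/
def partitionsOf (n k : ℕ) : Finset (Fin n → ℕ) :=
  (Finset.piAntidiag Finset.univ k).filter fun κ => ∀ i j : Fin n, i ≤ j → κ j ≤ κ i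

/-- The complete homogeneous symmetric polynomial `h_m(x₁, …, xₙ)`, with `h_m = 0` for `m < 0`. -/
def completeHomogeneous {n : ℕ} (x : Fin n → ℂ) (m : ℤ) : ℂ :=
  if 0 ≤ m then MvPolynomial.eval x (MvPolynomial.hsymm (Fin n) ℂ m.toNat) else 0

/-- The Schur polynomial `s_κ(x₁, …, xₙ)` (the character of the general linear group with highest
weight `κ`), as the determinant `det (h_{κ_i - i + j}(x))`.  It is the polynomial which extends the
quotient `det (x_i ^ (κ_j + n - j)) / det (x_i ^ (n - j))` to arguments that are not distinct, see
`schur_mul_alternant`. -/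
def schur {n : ℕ} (κ : Fin n → ℕ) (x : Fin n → ℂ) : ℂ :=
  Matrix.det (Matrix.of fun i j : Fin n =>
    completeHomogeneous x ((κ i : ℤ) - ((i : ℕ) : ℤ) + ((j : ℕ) : ℤ)))

section bialternant

open PowerSeries

theorem coeff_prod_geometric {n : ℕ} (x : Fin n → ℂ) (m : ℕ) :
    coeff m (∏ i, PowerSeries.mk fun k => x i ^ k) = completeHomogeneous x m := by
  have h0 : (0 : ℤ) ≤ m := by positivity
  rw [coeff_prod, completeHomogeneous, if_pos h0, Int.toNat_natCast, MvPolynomial.hsymm, map_sum]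
  symm
  refine Finset.sum_bij (fun s _ => Multiset.toFinsupp (s : Multiset (Fin n))) ?_ ?_ ?_ ?_
  · intro s _
    have h := Finsupp.card_toMultiset (Multiset.toFinsupp (s : Multiset (Fin n)))
    rw [Multiset.toFinsupp_toMultiset, Finsupp.sum_fintype _ _ (by simp)] at h
    simp only [Finset.mem_finsuppAntidiag, Finset.subset_univ, and_true]
    exact h.symm.trans s.2
  · intro s _ t _ h
    exact Subtype.ext (Multiset.toFinsupp.injective h)
  · intro f hf
    simp only [Finset.mem_finsuppAntidiag] at hf
    refine ⟨⟨Finsupp.toMultiset f, ?_⟩, Finset.mem_univ _, ?_⟩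
    · rw [Finsupp.card_toMultiset, Finsupp.sum_fintype _ _ (by simp)]
      exact hf.1
    · simp
  · intro s _
    rw [Finset.prod_multiset_map_count, map_prod]
    simp only [coeff_mk, map_pow, MvPolynomial.eval_X, Multiset.toFinsupp_apply]
    apply Finset.prod_subset (Finset.subset_univ _)
    intro i _ hi
    simp at hi
    simp [hi]

theorem pow_eq_sum_completeHomogeneous {n : ℕ} (x : Fin n → ℂ) (i : Fin n) :
    ∃ e : Fin n → ℂ, ∀ m : ℕ,
      x i ^ m = ∑ j : Fin n, e j * completeHomogeneous x ((m : ℤ) - (n : ℤ) + 1 + ((j : ℕ) : ℤ)) := by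
  set P : Polynomial ℂ := ∏ s ∈ Finset.univ.erase i, (1 - Polynomial.C (x s) * Polynomial.X) with hP
  have hdeg : P.natDegree < n := by
    have h1 : P.natDegree ≤ ∑ s ∈ Finset.univ.erase i, 1 := by
      refine (Polynomial.natDegree_prod_le _ _).trans (Finset.sum_le_sum fun s _ => ?_)
      compute_degree
    have h2 := i.pos
    simp at h1
    omega
  have hgeo : ∀ s, (PowerSeries.mk fun k => x s ^ k) * (1 - PowerSeries.C (x s) * PowerSeries.X) = 1 := by
    intro s
    ext k
    rcases k with _ | k
    · simp
    · rw [mul_sub, mul_one, ← mul_assoc, map_sub, coeff_succ_mul_X, mul_comm, coeff_C_mul]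
      simp [pow_succ', coeff_one]
  have hprod : (∏ s, PowerSeries.mk fun k => x s ^ k) * (P : PowerSeries ℂ) =
      PowerSeries.mk fun k => x i ^ k := by
    rw [← Finset.mul_prod_erase _ _ (Finset.mem_univ i), mul_assoc]
    have : (P : PowerSeries ℂ) = ∏ s ∈ Finset.univ.erase i, (1 - PowerSeries.C (x s) * PowerSeries.X) := by
      rw [hP, ← Polynomial.coeToPowerSeries.ringHom_apply, map_prod]
      simp
    rw [this, ← Finset.prod_mul_distrib]
    simp [hgeo]
  refine ⟨fun j => P.coeff (n - 1 - j), fun m => ?_⟩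
  have hc := congrArg (coeff m) hprod
  rw [coeff_mk, coeff_mul] at hc
  rw [← hc, Finset.Nat.sum_antidiagonal_eq_sum_range_succ_mk, ← Finset.sum_range_reflect,
    ← Equiv.sum_comp Fin.revPerm]
  have hfin : ∀ F : ℕ → ℂ, ∑ j : Fin n, F (j : ℕ) = ∑ j ∈ Finset.range n, F j :=
    fun F => Fin.sum_univ_eq_sum_range F n
  trans ∑ d ∈ Finset.range n, P.coeff d * completeHomogeneous x ((m : ℤ) - d)
  · have hz : ∀ d, m < d → completeHomogeneous x ((m : ℤ) - d) = 0 := by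
      intro d hd
      rw [completeHomogeneous, if_neg (by omega)]
    have hz' : ∀ d, n ≤ d → P.coeff d = 0 := fun d hd =>
      Polynomial.coeff_eq_zero_of_natDegree_lt (by omega)
    trans ∑ d ∈ Finset.range (m + 1 + n), P.coeff d * completeHomogeneous x ((m : ℤ) - d)
    · rw [Finset.sum_subset_zero_on_sdiff (s₁ := Finset.range (m + 1))
        (s₂ := Finset.range (m + 1 + n)) (g := fun d => P.coeff d * completeHomogeneous x ((m : ℤ) - d))]
      · intro d; simp; omega
      · intro d hd
        simp at hd
        rw [hz d (by omega), mul_zero]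
      · intro d hd
        simp at hd
        have e1 : m + 1 - 1 - d = m - d := by omega
        have e2 : m - (m - d) = d := by omega
        simp only [e1, e2]
        rw [coeff_prod_geometric, Polynomial.coeff_coe, mul_comm]
        congr 2
        omega
    · symm
      apply Finset.sum_subset_zero_on_sdiff
      · intro d; simp; omega
      · intro d hd
        simp at hd
        rw [hz' d (by omega), zero_mul]
      · intros; rfl
  · rw [← hfin fun d => P.coeff d * completeHomogeneous x ((m : ℤ) - d)]
    refine Finset.sum_congr rfl fun j _ => ?_
    have := j.2
    simp only [Fin.revPerm_apply, Fin.val_rev]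
    congr 2 <;> omega

theorem schur_mul_alternant {n : ℕ} (κ : Fin n → ℕ) (x : Fin n → ℂ) :
    schur κ x * Matrix.det (Matrix.of fun i j : Fin n => x i ^ (n - 1 - (j : ℕ))) =
      Matrix.det (Matrix.of fun i j : Fin n => x i ^ (κ j + (n - 1 - (j : ℕ)))) := by
  choose e he using pow_eq_sum_completeHomogeneous x
  have key : ∀ κ : Fin n → ℕ, (Matrix.of fun i j : Fin n => x i ^ (κ j + (n - 1 - (j : ℕ)))) =
      Matrix.of e * (Matrix.of fun i j : Fin n =>
        completeHomogeneous x ((κ i : ℤ) - ((i : ℕ) : ℤ) + ((j : ℕ) : ℤ))).transpose := by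
    intro κ
    ext i j
    rw [Matrix.mul_apply, Matrix.of_apply, he]
    refine Finset.sum_congr rfl fun l _ => ?_
    have := j.2
    simp only [Matrix.of_apply, Matrix.transpose_apply]
    congr 2
    omega
  have h0 : schur (0 : Fin n → ℕ) x = 1 := by
    rw [schur, Matrix.det_of_isUpperTriangular]
    · refine Finset.prod_eq_one fun i _ => ?_
      simp [completeHomogeneous]
    · intro i j hij
      have : (j : ℕ) < i := hij
      simp only [Matrix.of_apply, completeHomogeneous]
      rw [if_neg]
      simp
      omega
  have hd : ∀ κ : Fin n → ℕ, Matrix.det (Matrix.of fun i j : Fin n => x i ^ (κ j + (n - 1 - (j : ℕ)))) =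
      (Matrix.of e).det * schur κ x := by
    intro κ
    rw [key, Matrix.det_mul, Matrix.det_transpose, schur]
  have h1 := hd 0
  simp only [Pi.zero_apply, zero_add] at h1
  rw [hd κ, h1, h0]
  ring

end bialternant

/-- The dimension of the irreducible representation of the symmetric group `S_k`, `k = |κ|`,
attached to `κ`: with `κ` a partition with at most `n` parts (indexed from `1`) it is
`k! ∏_{i < j} (κ_i - κ_j - i + j) / ∏_j (n + κ_j - j)!`. -/
def symmetricGroupDim {n : ℕ} (κ : Fin n → ℕ) : ℂ :=
  ((∑ i, κ i)! : ℂ) *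
    (∏ i : Fin n, ∏ j ∈ Finset.Ioi i, ((κ i : ℂ) - κ j - (i : ℕ) + (j : ℕ))) /
      ∏ j : Fin n, ((κ j + (n - 1 - (j : ℕ)))! : ℂ)

/-- The `C`-normalized Jack polynomial `C_κ^{(α)}(x₁, …, xₙ)` with `α = 1`, that is, the complex
zonal polynomial; the normalization is `∑_{κ ⊢ k} C_κ(x) = (x₁ + ⋯ + xₙ)^k`. -/
def zonal {n : ℕ} (κ : Fin n → ℕ) (x : Fin n → ℂ) : ℂ :=
  symmetricGroupDim κ * schur κ x

/-! ### Pochhammer symbols and hypergeometric functions -/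

/-- The rising factorial `(z)_k = z (z + 1) ⋯ (z + k - 1)`; it is `Γ(z + k) / Γ(z)`, and therefore
`(z + k - 1)! / (z - 1)!`, whenever `z` is not a pole of `Γ`, see `pochhammer_eq_Gamma_div`, and it
is the continuous extension of that quotient elsewhere. -/
def pochhammer (z : ℂ) (k : ℕ) : ℂ :=
  (ascPochhammer ℂ k).eval z

theorem pochhammer_eq_Gamma_div (z : ℂ) (k : ℕ) (hz : ∀ m : ℕ, z ≠ -(m : ℂ)) :
    pochhammer z k = Complex.Gamma (z + k) / Complex.Gamma z :=
  (Complex.Gamma_add_nat_div_Gamma_eq z hz).symm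

/-- The generalized Pochhammer symbol `(a)_κ^{(α)}` with `α = 1`:
`∏_i Γ(a - (i - 1) + κ_i) / Γ(a - (i - 1))`, with `i` running from `1`. -/
def pochhammerPartition {n : ℕ} (a : ℂ) (κ : Fin n → ℕ) : ℂ :=
  ∏ i : Fin n, pochhammer (a - (i : ℕ)) (κ i)

/-- The homogeneous part of degree `k` of the series of the hypergeometric function of two matrix
arguments with `α = 1`. -/
def matrixPFQTerm {n p q : ℕ} (a : Fin p → ℂ) (b : Fin q → ℂ) (x y : Fin n → ℂ) (k : ℕ) : ℂ :=
  1 / (k ! : ℂ) * ∑ κ ∈ partitionsOf n k,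
    (∏ j, pochhammerPartition (a j) κ) / (∏ j, pochhammerPartition (b j) κ) *
      (zonal κ x * zonal κ y / zonal κ (fun _ => 1))

/-- The hypergeometric function `ₚF_q^{(1)}(a; b; X, Y)` of the two matrix arguments
`X = diag(x₁, …, xₙ)` and `Y = diag(y₁, …, yₙ)`. -/
def matrixPFQ {n p q : ℕ} (a : Fin p → ℂ) (b : Fin q → ℂ) (x y : Fin n → ℂ) : ℂ :=
  ∑' k : ℕ, matrixPFQTerm a b x y k

/-- The classical hypergeometric function `ₚF_q(a; b; z)` of one variable. -/
def scalarPFQ {p q : ℕ} (a : Fin p → ℂ) (b : Fin q → ℂ) (z : ℂ) : ℂ :=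
  ∑' k : ℕ, 1 / (k ! : ℂ) * ((∏ j, pochhammer (a j) k) / ∏ j, pochhammer (b j) k) * z ^ k

/-! ### Contours -/

/-- A closed curve that can be integrated along: differentiable off a finite set of parameters,
with integrable derivative.  Every piecewise continuously differentiable closed curve is one. -/
def IsContour {z₀ : ℂ} (γ : Path z₀ z₀) : Prop :=
  (∃ S : Set ℝ, S.Finite ∧ ∀ t ∈ Set.Ioo (0 : ℝ) 1 \ S, DifferentiableAt ℝ γ.extend t) ∧
    IntervalIntegrable (derivWithin γ.extend (Set.Icc 0 1)) MeasureTheory.volume 0 1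

/-- The contour integral `∮_γ f(z) dz`. -/
def contourIntegral {z₀ : ℂ} (γ : Path z₀ z₀) (f : ℂ → ℂ) : ℂ :=
  curveIntegral (fun z => f z • ContinuousLinearMap.id ℂ ℂ) γ

/-- `γ` encloses `w` counter-clockwise: it avoids `w` and has winding number `1` around it. -/
def Encloses {z₀ : ℂ} (γ : Path z₀ z₀) (w : ℂ) : Prop :=
  w ∉ Set.range γ ∧
    1 / (2 * Real.pi * Complex.I) * contourIntegral γ (fun z => (z - w)⁻¹) = 1

/-! ### Constants and matrix of the determinant formula -/

/-- `K(a, b) = ∏_{ℓ=1}^r [(n-ℓ)! ∏_i (b_i-ℓ)!/(b_i-n)! ∏_j (a_j-n)!/(a_j-ℓ)!]`, where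
`(c - ℓ)! / (c - n)! = (c - n + 1)_{n - ℓ}`. -/
def constK {p q : ℕ} (n r : ℕ) (a : Fin p → ℂ) (b : Fin q → ℂ) : ℂ :=
  ∏ l ∈ Finset.Icc 1 r, (((n - l)! : ℂ) *
    (∏ i, pochhammer (b i - n + 1) (n - l)) * ∏ j, (pochhammer (a j - n + 1) (n - l))⁻¹)

/-- `K_k(a, b) = ∏_{j=1}^{k-1} [1/(k-j)! · ∏_i (a_i-n+j)!/(a_i-n)! / ∏_i (b_i-n+j)!/(b_i-n)!]`, where
`(c - n + j)! / (c - n)! = (c - n + 1)_j`; it is `1` for `k = 1`. -/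
def constKMult {p q : ℕ} (n k : ℕ) (a : Fin p → ℂ) (b : Fin q → ℂ) : ℂ :=
  ∏ j ∈ Finset.Icc 1 (k - 1), (1 / ((k - j)! : ℂ) *
    ((∏ i, pochhammer (a i - n + 1) j) / ∏ i, pochhammer (b i - n + 1) j))

/-- The entry in row `i` and column `j` (both counted from `1`) of the block that belongs to a
value `ξ` of multiplicity `k`:
`(2πι)⁻¹ ∮ ₚF_q(a-n+1+k-i; b-n+1+k-i; ξ z) z^(k-i+j-1) / ∏_s (z - y_s) dz`. -/
def blockEntry {n p q : ℕ} (a : Fin p → ℂ) (b : Fin q → ℂ) (y : Fin n → ℂ)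
    {z₀ : ℂ} (γ : Path z₀ z₀) (ξ : ℂ) (k i j : ℕ) : ℂ :=
  1 / (2 * Real.pi * Complex.I) * contourIntegral γ fun z =>
    scalarPFQ (fun u => a u - n + 1 + k - i) (fun v => b v - n + 1 + k - i) (ξ * z) *
      z ^ (k - i + j - 1) / ∏ s, (z - y s)

/-- The `r × r` matrix `A` with the blocks `A₁, …, A_M` on top of each other, where `A_ℓ` has `k_ℓ`
rows.  The composition `c` of `r` is `(k₁, …, k_M)`; the row `u` lies in the block `c.index u` and is
there the row `c.invEmbedding u` (counted from `0`). -/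
def blockMatrix {n p q r : ℕ} (c : Composition r) (a : Fin p → ℂ) (b : Fin q → ℂ)
    (ξ : Fin c.length → ℂ) (y : Fin n → ℂ) {z₀ : ℂ} (γ : Path z₀ z₀) :
    Matrix (Fin r) (Fin r) ℂ :=
  Matrix.of fun u j => blockEntry a b y γ (ξ (c.index u)) (c.blocksFun (c.index u))
    ((c.invEmbedding u : ℕ) + 1) ((j : ℕ) + 1)

end MatrixHypergeometric

end

/-! Let `c_m` be the `m`-th coefficient of the scalar series with parameters `a - n + 1`, `b - n +
1`, and let `μ_i = κ_i + n - i` (indices from 1). Up to the constant `∏ c_{n-i}`, the coefficient of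
`s_κ(x) s_κ(y)` in the matrix series is `∏ c_{μ_i}` (`matrixPFQTerm_mul_prod`): each factor of a
partition Pochhammer symbol completes to a scalar symbol of index `μ_i`, and the Weyl dimension
formula absorbs the zonal normalization.

Write `s_κ(x)` as a quotient of alternants and `s_κ(y)` as a Jacobi–Trudi determinant. Both are
minors with columns or rows selected by `μ`, so the sum over `κ` is an infinite Cauchy–Binet sum
(`hasSum_cauchyBinet`) and equals one `n × n` determinant of scalar series. Repeated `x_i` need no
limit: Hasse derivatives of powers replace powers (`schur_mul_confluent_alternant`,
`det_confluentPow`). Repeated `y_s` are harmless in the Jacobi–Trudi form.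

Each scalar series is a contour integral because `(2πι)⁻¹ ∮ z^m / ∏ (z - y_s) dz = h_{m+1-n}(y)`,
and a Hasse derivative of order `d` shifts all parameters by `d` (`pfqCoeff_add`). The rows with
`x_i = 0` form a unitriangular block, which leaves an `r × r` determinant (`det_contourEntry`). The
constants are `∏ c_{n-i}`, the coefficients released by the Hasse derivatives, and the confluent
Vandermonde determinant. -/

open scoped Nat

noncomputable section

namespace MatrixHypergeometric

/-! ### Contour integrals and residues of `z^m / ∏ (z - y_s)`. -/

section contour

variable {z₀ : ℂ} {γ : Path z₀ z₀}

theorem contourIntegral_eq (γ : Path z₀ z₀) (f : ℂ → ℂ) :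
    contourIntegral γ f =
      ∫ t in (0 : ℝ)..1, f (γ.extend t) * derivWithin γ.extend (Set.Icc 0 1) t := by
  rw [contourIntegral, curveIntegral_def]
  simp [curveIntegralFun_def, unitInterval]

theorem extend_mem_range (γ : Path z₀ z₀) (t : ℝ) : γ.extend t ∈ Set.range γ := by
  rw [← γ.extend_range]
  exact ⟨t, rfl⟩

theorem continuous_comp_extend {f : ℂ → ℂ} (hf : ContinuousOn f (Set.range γ)) :
    Continuous fun t => f (γ.extend t) :=
  hf.comp_continuous γ.continuous_extend (extend_mem_range γ)

theorem IsContour.intervalIntegrable (hγ : IsContour γ) {f : ℂ → ℂ}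
    (hf : ContinuousOn f (Set.range γ)) :
    IntervalIntegrable (fun t => f (γ.extend t) * derivWithin γ.extend (Set.Icc 0 1) t)
      MeasureTheory.volume 0 1 :=
  hγ.2.continuousOn_mul (continuous_comp_extend hf).continuousOn

theorem IsContour.contourIntegral_add (hγ : IsContour γ) {f g : ℂ → ℂ}
    (hf : ContinuousOn f (Set.range γ)) (hg : ContinuousOn g (Set.range γ)) :
    contourIntegral γ (fun z => f z + g z) = contourIntegral γ f + contourIntegral γ g := by
  simp only [contourIntegral_eq]
  rw [← intervalIntegral.integral_add (hγ.intervalIntegrable hf) (hγ.intervalIntegrable hg)]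
  simp only [add_mul]

theorem contourIntegral_const_mul (c : ℂ) (f : ℂ → ℂ) :
    contourIntegral γ (fun z => c * f z) = c * contourIntegral γ f := by
  simp only [contourIntegral_eq]
  rw [← intervalIntegral.integral_const_mul]
  simp only [mul_assoc]

theorem contourIntegral_congr {f g : ℂ → ℂ} (h : Set.EqOn f g (Set.range γ)) :
    contourIntegral γ f = contourIntegral γ g := by
  simp only [contourIntegral_eq]
  congr 1
  ext t
  rw [h (extend_mem_range γ t)]

/-- Fundamental theorem of calculus along a closed curve: the two endpoint values of the primitive
cancel. A primitive is needed only at the points of the curve, so no global form of Cauchy's theorem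
enters. -/
theorem IsContour.contourIntegral_eq_zero_of_hasDerivAt (hγ : IsContour γ) {F f : ℂ → ℂ}
    (hF : ∀ z ∈ Set.range γ, HasDerivAt F (f z) z) (hf : ContinuousOn f (Set.range γ)) :
    contourIntegral γ f = 0 := by
  obtain ⟨S, hS, hd⟩ := hγ.1
  rw [contourIntegral_eq, MeasureTheory.integral_eq_of_hasDerivAt_off_countable_of_le
    (fun t => F (γ.extend t)) _ zero_le_one hS.countable _ _ (hγ.intervalIntegrable hf)]
  · simp
  · exact (continuous_comp_extend (f := F)
      fun z hz => (hF z hz).continuousAt.continuousWithinAt).continuousOn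
  · intro t ht
    have h1 := (hd t ht).hasDerivAt
    rw [← derivWithin_of_mem_nhds (Icc_mem_nhds ht.1.1 ht.1.2)] at h1
    have := (hF _ (extend_mem_range γ t)).scomp t h1
    rwa [smul_eq_mul, mul_comm] at this

theorem IsContour.hasSum_contourIntegral (hγ : IsContour γ) {F : ℕ → ℂ → ℂ} {f : ℂ → ℂ}
    {u : ℕ → ℝ} (hF : ∀ m, ContinuousOn (F m) (Set.range γ)) (hu : Summable u)
    (hFu : ∀ m, ∀ z ∈ Set.range γ, ‖F m z‖ ≤ u m)
    (hf : ∀ z ∈ Set.range γ, HasSum (fun m => F m z) (f z)) :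
    HasSum (fun m => contourIntegral γ (F m)) (contourIntegral γ f) := by
  simp only [contourIntegral_eq]
  refine intervalIntegral.hasSum_integral_of_dominated_convergence
    (fun m t => u m * ‖derivWithin γ.extend (Set.Icc 0 1) t‖) (fun m => ?_) (fun m => ?_) ?_ ?_ ?_
  · have := (hγ.intervalIntegrable (hF m)).aestronglyMeasurable
    rwa [Set.uIoc_of_le zero_le_one]
  · refine .of_forall fun t _ => ?_
    rw [norm_mul]
    exact mul_le_mul_of_nonneg_right (hFu m _ (extend_mem_range γ t)) (norm_nonneg _)
  · exact .of_forall fun t _ => hu.mul_right _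
  · simp only [tsum_mul_right]
    exact hγ.2.norm.const_mul _
  · exact .of_forall fun t _ => (hf _ (extend_mem_range γ t)).mul_right _

variable {n : ℕ} {y : Fin n → ℂ}

theorem continuousOn_pow_div_prod (hy : ∀ s, Encloses γ (y s)) (S : Finset (Fin n)) (m : ℕ) :
    ContinuousOn (fun z => z ^ m / ∏ s ∈ S, (z - y s)) (Set.range γ) := by
  refine ContinuousOn.div (by fun_prop) (by fun_prop) fun z hz => ?_
  exact Finset.prod_ne_zero_iff.2 fun s _ => sub_ne_zero.2 fun h => (hy s).1 (h ▸ hz)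

theorem Encloses.contourIntegral_inv {w : ℂ} (h : Encloses γ w) :
    contourIntegral γ (fun z => (z - w)⁻¹) = 2 * Real.pi * Complex.I := by
  have := h.2
  have h2 := Complex.two_pi_I_ne_zero
  rw [one_div, inv_mul_eq_iff_eq_mul₀ h2, mul_one] at this
  exact this

/-- A simple fraction with at least two poles has no residue at infinity. -/
theorem IsContour.contourIntegral_inv_prod (hγ : IsContour γ) (hy : ∀ s, Encloses γ (y s))
    (S : Finset (Fin n)) (hS : 2 ≤ S.card) :
    contourIntegral γ (fun z => 1 / ∏ s ∈ S, (z - y s)) = 0 := by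
  classical
  have hne : ∀ z ∈ Set.range γ, ∀ s, z - y s ≠ 0 := fun z hz s =>
    sub_ne_zero.2 fun h => (hy s).1 (h ▸ hz)
  have hcont : ∀ T : Finset (Fin n),
      ContinuousOn (fun z => 1 / ∏ s ∈ T, (z - y s)) (Set.range γ) := fun T => by
    simpa using continuousOn_pow_div_prod hy T 0
  induction hk : S.card using Nat.strong_induction_on generalizing S with
  | _ k ih =>
    -- Two different poles are separated by partial fractions, which lowers the number of factors by
    -- one; the two coefficients are opposite.
    by_cases h : ∃ s ∈ S, ∃ t ∈ S, y s ≠ y t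
    · obtain ⟨s, hs, t, ht, hst⟩ := h
      have hst0 := sub_ne_zero.2 hst
      have hcs := Finset.card_erase_of_mem hs
      have hct := Finset.card_erase_of_mem ht
      rw [contourIntegral_congr (g := fun z => (y s - y t)⁻¹ *
          (1 / ∏ u ∈ S.erase t, (z - y u)) + (-(y s - y t)⁻¹) * (1 / ∏ u ∈ S.erase s, (z - y u)))]
      · rw [hγ.contourIntegral_add, contourIntegral_const_mul, contourIntegral_const_mul]
        · by_cases h3 : 3 ≤ S.card
          · rw [ih _ (by omega) (S.erase s) (by omega) rfl, ih _ (by omega) (S.erase t) (by omega) rfl]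
            simp
          · obtain ⟨s', hs'⟩ := Finset.card_eq_one.1 (by omega : (S.erase s).card = 1)
            obtain ⟨t', ht'⟩ := Finset.card_eq_one.1 (by omega : (S.erase t).card = 1)
            simp [hs', ht', (hy _).contourIntegral_inv]
        · exact continuousOn_const.mul (hcont _)
        · exact continuousOn_const.mul (hcont _)
      · intro z hz
        have h1 := Finset.mul_prod_erase S (fun u => z - y u) hs
        have h2 := Finset.mul_prod_erase S (fun u => z - y u) ht
        have h3 := hne z hz
        have h4 : ∏ u ∈ S.erase s, (z - y u) ≠ 0 := Finset.prod_ne_zero_iff.2 fun u _ => h3 u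
        have h5 : ∏ u ∈ S.erase t, (z - y u) ≠ 0 := Finset.prod_ne_zero_iff.2 fun u _ => h3 u
        have h6 : ∏ u ∈ S, (z - y u) ≠ 0 := Finset.prod_ne_zero_iff.2 fun u _ => h3 u
        have e1 : 1 / ∏ u ∈ S.erase s, (z - y u) = (z - y s) / ∏ u ∈ S, (z - y u) := by
          rw [← h1]; field_simp [h3 s]
        have e2 : 1 / ∏ u ∈ S.erase t, (z - y u) = (z - y t) / ∏ u ∈ S, (z - y u) := by
          rw [← h2]; field_simp [h3 t]
        simp only [e1, e2]
        field_simp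
        ring
    · push Not at h
      -- All poles coincide: the integrand is a power of exponent at most `-2`, which has a
      -- primitive.
      obtain ⟨s, hs⟩ := Finset.card_pos.1 (by omega : 0 < S.card)
      have heq : ∀ z, ∏ u ∈ S, (z - y u) = (z - y s) ^ S.card := fun z => by
        rw [← Finset.prod_const]
        exact Finset.prod_congr rfl fun u hu => by rw [h u hu s hs]
      refine hγ.contourIntegral_eq_zero_of_hasDerivAt
        (F := fun z => -((S.card - 1 : ℕ) : ℂ)⁻¹ * ((z - y s) ^ (S.card - 1))⁻¹) (fun z hz => ?_)
        (hcont S)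
      have h3 := hne z hz s
      obtain ⟨c, hc⟩ := Nat.exists_eq_add_of_le' hS
      have hc0 : ((c : ℂ) + 1) ≠ 0 := by exact_mod_cast c.succ_ne_zero
      have := ((((hasDerivAt_id z).sub_const (y s)).pow (c + 1)).inv (pow_ne_zero _ h3)).const_mul
        (-((c + 1 : ℕ) : ℂ)⁻¹)
      rw [heq, hc]
      rw [show c + 2 - 1 = c + 1 from rfl]
      refine HasDerivAt.congr_deriv this ?_
      simp only [id, Pi.pow_apply, Nat.add_sub_cancel, mul_one] at h3 ⊢
      push_cast
      field_simp
      ring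

open PowerSeries in
-- Induction on `m` by `z = (z - y_s) + y_s`, matched on the series side by `1/(1 - y_s X) = 1 + y_s
-- X/(1 - y_s X)`. The first summand cancels a factor, hence the general subset `S`. For empty `S`
-- both sides vanish, since `m + 1 > 0`.
theorem IsContour.contourIntegral_pow_div_prod (hγ : IsContour γ) (hy : ∀ s, Encloses γ (y s))
    (m : ℕ) (S : Finset (Fin n)) :
    1 / (2 * Real.pi * Complex.I) * contourIntegral γ (fun z => z ^ m / ∏ s ∈ S, (z - y s)) =
      coeff (m + 1) (X ^ S.card * ∏ s ∈ S, PowerSeries.mk fun k => y s ^ k) := by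
  classical
  have h2 := Complex.two_pi_I_ne_zero
  have hempty : ∀ m : ℕ, contourIntegral γ (fun z => z ^ m / ∏ s ∈ (∅ : Finset (Fin n)),
      (z - y s)) = 0 := fun m => by
    refine hγ.contourIntegral_eq_zero_of_hasDerivAt (F := fun z => z ^ (m + 1) / (m + 1))
      (fun z _ => ?_) (by simpa using (continuous_pow m).continuousOn)
    have hm : ((m : ℂ) + 1) ≠ 0 := by exact_mod_cast m.succ_ne_zero
    have := (hasDerivAt_pow (m + 1) z).div_const ((m : ℂ) + 1)
    refine HasDerivAt.congr_deriv this ?_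
    simp only [Finset.prod_empty, div_one]
    push_cast
    field_simp
  induction m generalizing S with
  | zero =>
    rcases lt_trichotomy S.card 1 with h | h | h
    · obtain rfl : S = ∅ := Finset.card_eq_zero.1 (by omega)
      rw [hempty]
      simp [coeff_one]
    · obtain ⟨s, rfl⟩ := Finset.card_eq_one.1 h
      simp only [zero_add, pow_zero, Finset.prod_singleton, one_div,
        (hy s).contourIntegral_inv, Finset.card_singleton, pow_one]
      have := coeff_succ_X_mul 0 (PowerSeries.mk fun k => y s ^ k)
      rw [zero_add] at this
      rw [this, inv_mul_cancel₀ h2]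
      simp
    · simp only [pow_zero]
      rw [hγ.contourIntegral_inv_prod hy S h, mul_zero, coeff_X_pow_mul', if_neg (by omega)]
  | succ m ih =>
    rcases S.eq_empty_or_nonempty with rfl | ⟨s, hs⟩
    · rw [hempty]
      simp [coeff_one]
    · have hgeo : (PowerSeries.mk fun k => y s ^ k) =
          1 + C (y s) * (X * PowerSeries.mk fun k => y s ^ k) := by
        ext k
        rcases k with _ | k
        · simp
        · rw [map_add, coeff_C_mul, coeff_succ_X_mul]
          simp [pow_succ', coeff_one]
      have hps : (X ^ S.card * ∏ s ∈ S, PowerSeries.mk fun k => y s ^ k) =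
          X * (X ^ (S.erase s).card * ∏ s ∈ S.erase s, PowerSeries.mk fun k => y s ^ k) +
          C (y s) * (X * (X ^ S.card * ∏ s ∈ S, PowerSeries.mk fun k => y s ^ k)) := by
        rw [← Finset.mul_prod_erase S _ hs, ← Finset.card_erase_add_one hs]
        conv_lhs => rw [hgeo]
        ring
      rw [hps, map_add, coeff_C_mul, coeff_succ_X_mul, coeff_succ_X_mul, ← ih, ← ih]
      rw [contourIntegral_congr (g := fun z => z ^ m / ∏ u ∈ S.erase s, (z - y u) +
        y s * (z ^ m / ∏ u ∈ S, (z - y u))), hγ.contourIntegral_add, contourIntegral_const_mul]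
      · ring
      · exact continuousOn_pow_div_prod hy _ m
      · exact continuousOn_const.mul (continuousOn_pow_div_prod hy _ m)
      · intro z hz
        have h3 : ∀ u, z - y u ≠ 0 := fun u => sub_ne_zero.2 fun h => (hy u).1 (h ▸ hz)
        have h4 : ∏ u ∈ S.erase s, (z - y u) ≠ 0 := Finset.prod_ne_zero_iff.2 fun u _ => h3 u
        have h5 := h3 s
        simp only [← Finset.mul_prod_erase S (fun u => z - y u) hs]
        field_simp
        ring

theorem IsContour.contourIntegral_pow_div_prod_univ (hγ : IsContour γ)
    (hy : ∀ s, Encloses γ (y s)) (m : ℕ) :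
    1 / (2 * Real.pi * Complex.I) * contourIntegral γ (fun z => z ^ m / ∏ s, (z - y s)) =
      completeHomogeneous y ((m : ℤ) + 1 - n) := by
  rw [hγ.contourIntegral_pow_div_prod hy, Finset.card_univ, Fintype.card_fin,
    PowerSeries.coeff_X_pow_mul', coeff_prod_geometric]
  split_ifs with h
  · congr 1
    omega
  · rw [completeHomogeneous, if_neg (by omega)]

end contour

/-! ### Alternants with repeated arguments, and the Weyl dimension formula. -/

section confluent

open PowerSeries

variable {n : ℕ}

/-- The number of later coordinates of `x` that agree with `x u`. -/
def confluentOrder (x : Fin n → ℂ) (u : Fin n) : ℕ :=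
  ((Finset.Ioi u).filter fun s => x s = x u).card

/-- The Hasse derivative of order `confluentOrder x u` of `z ^ m`, at `z = x u`. -/
def confluentPow (x : Fin n → ℂ) (u : Fin n) (m : ℕ) : ℂ :=
  m.choose (confluentOrder x u) * x u ^ (m - confluentOrder x u)

theorem card_insert_confluentOrder (x : Fin n → ℂ) (u : Fin n) :
    ((Finset.Ici u).filter fun s => x s = x u).card = confluentOrder x u + 1 := by
  rw [confluentOrder, ← Finset.Ioi_insert, Finset.filter_insert, if_pos rfl,
    Finset.card_insert_of_notMem (by simp)]

theorem confluentOrder_lt (x : Fin n → ℂ) (u : Fin n) : confluentOrder x u < n := by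
  have h := Finset.card_le_univ ((Finset.Ici u).filter fun s => x s = x u)
  rw [card_insert_confluentOrder, Fintype.card_fin] at h
  omega

theorem mk_pow_mul_one_sub (w : ℂ) :
    (PowerSeries.mk fun k => w ^ k) * (1 - PowerSeries.C w * PowerSeries.X) = 1 := by
  ext k
  rcases k with _ | k
  · simp
  · rw [mul_sub, mul_one, ← mul_assoc, map_sub, coeff_succ_mul_X, mul_comm, coeff_C_mul]
    simp [pow_succ', coeff_one]

/-- This is the Hasse derivative of order `d` in `w` of the geometric series `1/(1 - wX)`. Pascal's
rule clears the denominator one factor at a time. -/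
theorem mk_choose_mul_pow (w : ℂ) (d : ℕ) :
    (PowerSeries.mk fun m => (m.choose d : ℂ) * w ^ (m - d)) =
      X ^ d * (PowerSeries.mk fun k => w ^ k) ^ (d + 1) := by
  have key : ∀ d, (PowerSeries.mk fun m => (m.choose d : ℂ) * w ^ (m - d)) * (1 - C w * X) ^ (d + 1)
      = X ^ d := by
    intro d
    induction d with
    | zero => simpa using mk_pow_mul_one_sub w
    | succ d ih =>
      have : (PowerSeries.mk fun m => (m.choose (d + 1) : ℂ) * w ^ (m - (d + 1))) * (1 - C w * X) =
          X * (PowerSeries.mk fun m => (m.choose d : ℂ) * w ^ (m - d)) := by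
        ext m
        rcases m with _ | m
        · simp
        · rw [coeff_succ_X_mul, mul_sub, mul_one, mul_left_comm, ← mul_assoc, map_sub, mul_assoc,
            coeff_C_mul, coeff_succ_mul_X]
          simp only [coeff_mk, Nat.choose_succ_succ, Nat.add_sub_add_right]
          -- For `m ≤ d` the subtraction `m - (d + 1)` truncates, but the binomial coefficient in
          -- front of it is zero.
          rcases Nat.lt_or_ge d m with h | h
          · rw [show m - d = m - (d + 1) + 1 by omega, pow_succ]
            push_cast
            ring
          · rw [Nat.choose_eq_zero_of_lt (by omega : m < d + 1)]
            simp
      rw [pow_succ' _ (d + 1), ← mul_assoc, this, mul_assoc, ih, pow_succ']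
  rw [← key d, mul_assoc, ← mul_pow, mul_comm (1 - _), mk_pow_mul_one_sub, one_pow, mul_one]

theorem coeff_prod_geometric_mul (x : Fin n → ℂ) (P : Polynomial ℂ) (hdeg : P.natDegree < n)
    (m : ℕ) : coeff m ((∏ s, PowerSeries.mk fun k => x s ^ k) * (P : PowerSeries ℂ)) =
      ∑ j : Fin n, P.coeff (n - 1 - j) *
        completeHomogeneous x ((m : ℤ) - (n : ℤ) + 1 + ((j : ℕ) : ℤ)) := by
  rw [coeff_mul, Finset.Nat.sum_antidiagonal_eq_sum_range_succ_mk, ← Finset.sum_range_reflect,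
    ← Equiv.sum_comp Fin.revPerm]
  have hfin : ∀ F : ℕ → ℂ, ∑ j : Fin n, F (j : ℕ) = ∑ j ∈ Finset.range n, F j :=
    fun F => Fin.sum_univ_eq_sum_range F n
  trans ∑ d ∈ Finset.range n, P.coeff d * completeHomogeneous x ((m : ℤ) - d)
  · have hz : ∀ d, m < d → completeHomogeneous x ((m : ℤ) - d) = 0 := by
      intro d hd
      rw [completeHomogeneous, if_neg (by omega)]
    have hz' : ∀ d, n ≤ d → P.coeff d = 0 := fun d hd =>
      Polynomial.coeff_eq_zero_of_natDegree_lt (by omega)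
    -- The convolution stops at `m`, the polynomial below `n`. On a common longer range the extra
    -- terms vanish, since `h` is zero at negative indices and `P` has degree below `n`.
    trans ∑ d ∈ Finset.range (m + 1 + n), P.coeff d * completeHomogeneous x ((m : ℤ) - d)
    · refine Finset.sum_subset_zero_on_sdiff (fun d => by simp; omega) (fun d hd => ?_)
        (fun d hd => ?_)
      · simp at hd
        rw [hz d (by omega), mul_zero]
      · simp at hd
        have e1 : m + 1 - 1 - d = m - d := by omega
        have e2 : m - (m - d) = d := by omega
        simp only [e1, e2]
        rw [coeff_prod_geometric, Polynomial.coeff_coe, mul_comm]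
        congr 2
        omega
    · symm
      refine Finset.sum_subset_zero_on_sdiff (fun d => by simp; omega) (fun d hd => ?_)
        (fun _ _ => rfl)
      simp at hd
      rw [hz' d (by omega), zero_mul]
  · rw [← hfin fun d => P.coeff d * completeHomogeneous x ((m : ℤ) - d)]
    refine Finset.sum_congr rfl fun j _ => ?_
    have := j.2
    simp only [Fin.revPerm_apply, Fin.val_rev]
    congr 2 <;> omega

/-- The generating function `X^d/(1 - x_u X)^(d+1)` is `∏ 1/(1 - x_s X)` times `X^d ∏_{s ∉ T} (1 -
x_s X)`, where `T` consists of `u` and the `d` later equal coordinates. That polynomial has degree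
at most `d + n - (d + 1) = n - 1`, so `n` coefficients, the same for all `m`, suffice. -/
theorem confluentPow_eq_sum_completeHomogeneous (x : Fin n → ℂ) (u : Fin n) :
    ∃ e : Fin n → ℂ, ∀ m : ℕ, confluentPow x u m =
      ∑ j : Fin n, e j * completeHomogeneous x ((m : ℤ) - (n : ℤ) + 1 + ((j : ℕ) : ℤ)) := by
  set T := (Finset.Ici u).filter fun s => x s = x u with hT
  have hcard : T.card = confluentOrder x u + 1 := card_insert_confluentOrder x u
  set d := confluentOrder x u
  set P : Polynomial ℂ :=
    Polynomial.X ^ d * ∏ s ∈ Tᶜ, (1 - Polynomial.C (x s) * Polynomial.X) with hP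
  have hdeg : P.natDegree < n := by
    have h1 : (∏ s ∈ Tᶜ, (1 - Polynomial.C (x s) * Polynomial.X)).natDegree ≤ ∑ s ∈ Tᶜ, 1 := by
      refine (Polynomial.natDegree_prod_le _ _).trans (Finset.sum_le_sum fun s _ => ?_)
      compute_degree
    have h2 := Finset.card_compl_add_card T
    have h3 : P.natDegree ≤ _ := Polynomial.natDegree_mul_le
    rw [Polynomial.natDegree_X_pow] at h3
    rw [Finset.sum_const, smul_eq_mul, mul_one] at h1
    rw [Fintype.card_fin] at h2
    omega
  have hprod : (∏ s, PowerSeries.mk fun k => x s ^ k) * (P : PowerSeries ℂ) =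
      PowerSeries.mk fun m => (m.choose d : ℂ) * x u ^ (m - d) := by
    have hPc : (P : PowerSeries ℂ) =
        X ^ d * ∏ s ∈ Tᶜ, (1 - PowerSeries.C (x s) * PowerSeries.X) := by
      rw [hP, ← Polynomial.coeToPowerSeries.ringHom_apply, map_mul, map_prod]
      simp
    have hTp : ∏ s ∈ T, (PowerSeries.mk fun k => x s ^ k) =
        (PowerSeries.mk fun k => x u ^ k) ^ (d + 1) := by
      rw [← hcard]
      refine Finset.prod_eq_pow_card fun s hs => ?_
      rw [(Finset.mem_filter.1 hs).2]
    rw [mk_choose_mul_pow, ← hTp, hPc, ← Finset.prod_mul_prod_compl T, mul_left_comm, mul_assoc,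
      ← Finset.prod_mul_distrib]
    simp [mk_pow_mul_one_sub]
  refine ⟨fun j => P.coeff (n - 1 - j), fun m => ?_⟩
  rw [← coeff_prod_geometric_mul x P hdeg, hprod, coeff_mk, confluentPow]

theorem schur_zero (x : Fin n → ℂ) : schur (0 : Fin n → ℕ) x = 1 := by
  rw [schur, Matrix.det_of_isUpperTriangular]
  · refine Finset.prod_eq_one fun i _ => ?_
    simp [completeHomogeneous]
  · intro i j hij
    have : (j : ℕ) < i := hij
    simp only [Matrix.of_apply, completeHomogeneous]
    rw [if_neg]
    simp
    omega

/-- The bialternant formula for arguments that need not be distinct. -/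
theorem schur_mul_confluent_alternant (κ : Fin n → ℕ) (x : Fin n → ℂ) :
    schur κ x * Matrix.det (Matrix.of fun i j : Fin n => confluentPow x i (n - 1 - (j : ℕ))) =
      Matrix.det (Matrix.of fun i j : Fin n => confluentPow x i (κ j + (n - 1 - (j : ℕ)))) := by
  choose e he using confluentPow_eq_sum_completeHomogeneous x
  have hd : ∀ κ : Fin n → ℕ,
      Matrix.det (Matrix.of fun i j : Fin n => confluentPow x i (κ j + (n - 1 - (j : ℕ)))) =
      (Matrix.of e).det * schur κ x := by
    intro κ
    have key : (Matrix.of fun i j : Fin n => confluentPow x i (κ j + (n - 1 - (j : ℕ)))) =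
        Matrix.of e * (Matrix.of fun i j : Fin n =>
          completeHomogeneous x ((κ i : ℤ) - ((i : ℕ) : ℤ) + ((j : ℕ) : ℤ))).transpose := by
      ext i j
      rw [Matrix.mul_apply, Matrix.of_apply, he]
      refine Finset.sum_congr rfl fun l _ => ?_
      have := j.2
      simp only [Matrix.of_apply, Matrix.transpose_apply]
      congr 2
      omega
    rw [key, Matrix.det_mul, Matrix.det_transpose, schur]
  -- The matrix `e` does not depend on `κ`; the empty partition identifies its determinant as the
  -- denominator alternant.
  have h1 := hd 0
  simp only [Pi.zero_apply, zero_add] at h1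
  rw [hd κ, h1, schur_zero]
  ring

/-- Passing from powers to monic polynomials of the same degrees is a unitriangular column
operation, and Hasse derivatives are linear. -/
theorem det_hasseDeriv_eval (x : Fin n → ℂ) (d : Fin n → ℕ) (P : Fin n → Polynomial ℂ)
    (hm : ∀ j, (P j).Monic) (hdeg : ∀ j : Fin n, (P j).natDegree = n - 1 - (j : ℕ)) :
    Matrix.det (Matrix.of fun i j : Fin n => (Polynomial.hasseDeriv (d i) (P j)).eval (x i)) =
      Matrix.det (Matrix.of fun i j : Fin n =>
        ((n - 1 - (j : ℕ)).choose (d i) : ℂ) * x i ^ (n - 1 - (j : ℕ) - d i)) := by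
  have key : (Matrix.of fun i j : Fin n => (Polynomial.hasseDeriv (d i) (P j)).eval (x i)) =
      (Matrix.of fun i j : Fin n =>
        ((n - 1 - (j : ℕ)).choose (d i) : ℂ) * x i ^ (n - 1 - (j : ℕ) - d i)) *
      Matrix.of fun k j : Fin n => (P j).coeff (n - 1 - (k : ℕ)) := by
    ext i j
    rw [Matrix.mul_apply, Matrix.of_apply]
    conv_lhs => rw [(P j).as_sum_range' n (by have := j.2; rw [hdeg]; omega)]
    rw [map_sum, Polynomial.eval_finsetSum, ← Finset.sum_range_reflect, ← Fin.sum_univ_eq_sum_range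
      (fun k => (Polynomial.hasseDeriv (d i) (Polynomial.monomial (n - 1 - k)
        ((P j).coeff (n - 1 - k)))).eval (x i)) n]
    refine Finset.sum_congr rfl fun k _ => ?_
    simp only [Matrix.of_apply, Polynomial.hasseDeriv_monomial, Polynomial.eval_monomial]
    ring
  rw [key, Matrix.det_mul, Matrix.det_of_isLowerTriangular (Matrix.of fun k j : Fin n =>
    (P j).coeff (n - 1 - (k : ℕ))), Finset.prod_eq_one, mul_one]
  · intro j _
    rw [Matrix.of_apply, ← hdeg]
    exact hm j
  · intro k j hkj
    have h1 : (k : ℕ) < j := hkj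
    have h2 := j.2
    rw [Matrix.of_apply]
    exact Polynomial.coeff_eq_zero_of_natDegree_lt (by rw [hdeg]; omega)

theorem eval_hasseDeriv_X_sub_C_pow_mul (w : ℂ) (c d : ℕ) (q : Polynomial ℂ) :
    (Polynomial.hasseDeriv d ((Polynomial.X - Polynomial.C w) ^ c * q)).eval w =
      if c ≤ d then (Polynomial.taylor w q).coeff (d - c) else 0 := by
  rw [← Polynomial.taylor_coeff, Polynomial.taylor_mul, Polynomial.taylor_pow, map_sub,
    Polynomial.taylor_X, Polynomial.taylor_C, add_sub_cancel_right, Polynomial.coeff_X_pow_mul']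

/-- The confluent Vandermonde determinant. -/
theorem det_confluentPow (x : Fin n → ℂ) :
    Matrix.det (Matrix.of fun i j : Fin n => confluentPow x i (n - 1 - (j : ℕ))) =
      ∏ i : Fin n, ∏ j ∈ Finset.Ioi i, if x j = x i then 1 else x i - x j := by
  have hdeg : ∀ j : Fin n, (∏ s ∈ Finset.Ioi j, (Polynomial.X - Polynomial.C (x s))).natDegree =
      n - 1 - (j : ℕ) := fun j => by
    rw [Polynomial.natDegree_finsetProd_X_sub_C_eq_card, Fin.card_Ioi]
  have hsplit : ∀ T S : Finset (Fin n), T ⊆ S → ∀ w : ℂ, (∀ s ∈ T, x s = w) →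
      ∏ s ∈ S, (Polynomial.X - Polynomial.C (x s)) = (Polynomial.X - Polynomial.C w) ^ T.card *
        ∏ s ∈ S \ T, (Polynomial.X - Polynomial.C (x s)) := fun T S hTS w hw => by
    rw [← Finset.prod_sdiff hTS, mul_comm]
    congr 1
    exact Finset.prod_eq_pow_card fun s hs => by rw [hw s hs]
  simp only [confluentPow]
  -- With the Newton polynomials `∏_{s > j} (X - x_s)` the matrix is triangular: for `i > j` the
  -- factor `X - x_i` occurs more often than the order of the derivative. On the diagonal it occurs
  -- exactly that often, which leaves the product of the nonzero differences.
  rw [← det_hasseDeriv_eval x (confluentOrder x)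
    (fun j => ∏ s ∈ Finset.Ioi j, (Polynomial.X - Polynomial.C (x s)))
    (fun j => Polynomial.monic_prod_X_sub_C _ _) hdeg, Matrix.det_of_isUpperTriangular]
  · refine Finset.prod_congr rfl fun i _ => ?_
    rw [Matrix.of_apply, hsplit ((Finset.Ioi i).filter fun s => x s = x i) _
      (Finset.filter_subset _ _) (x i) (fun s hs => (Finset.mem_filter.1 hs).2),
      eval_hasseDeriv_X_sub_C_pow_mul, confluentOrder, if_pos le_rfl, Nat.sub_self,
      Polynomial.taylor_coeff_zero, Polynomial.eval_prod, Finset.prod_ite, Finset.prod_const_one,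
      one_mul, ← Finset.filter_not]
    simp
  · intro i j hij
    have hij : j < i := hij
    rw [Matrix.of_apply, hsplit ((Finset.Ici i).filter fun s => x s = x i) _
      (fun s hs => Finset.mem_Ioi.2 (hij.trans_le (Finset.mem_Ici.1 (Finset.mem_filter.1 hs).1)))
      (x i) (fun s hs => (Finset.mem_filter.1 hs).2),
      eval_hasseDeriv_X_sub_C_pow_mul, card_insert_confluentOrder, if_neg (by omega)]

/-- Weyl dimension formula. When all arguments are 1 the denominator alternant is 1 and the
numerator has entries `binom(μ_j, n-1-i)` (indices from 0). Multiplied by the factorials these are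
falling factorials, monic polynomials in `μ_j`, so the determinant is the Vandermonde determinant of
`μ`. -/
theorem prod_factorial_mul_schur_one (κ : Fin n → ℕ) (hκ : ∀ i j : Fin n, i ≤ j → κ j ≤ κ i) :
    (∏ i : Fin n, ((n - 1 - (i : ℕ))! : ℂ)) * schur κ (fun _ => 1) =
      ∏ i : Fin n, ∏ j ∈ Finset.Ioi i, ((κ i : ℂ) - κ j - (i : ℕ) + (j : ℕ)) := by
  have hord : ∀ u, confluentOrder (fun _ : Fin n => (1 : ℂ)) u = n - 1 - (u : ℕ) := fun u => by
    simp [confluentOrder]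
  have h1 := schur_mul_confluent_alternant κ (fun _ => 1)
  rw [det_confluentPow] at h1
  simp only [if_true, Finset.prod_const_one, mul_one, confluentPow, hord, one_pow] at h1
  set μ : Fin n → ℂ := fun j => ((κ j + (n - 1 - (j : ℕ)) : ℕ) : ℂ) with hμ
  have hinj : ∀ i, ∀ j ∈ Finset.Ioi i, μ j ≠ μ i := fun i j hj h => by
    have h2 : i < j := Finset.mem_Ioi.1 hj
    have h2' : (i : ℕ) < j := h2
    have h3 := hκ i j h2.le
    have h4 : κ j + (n - 1 - (j : ℕ)) = κ i + (n - 1 - (i : ℕ)) := Nat.cast_injective h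
    have := j.2
    omega
  have h2 := det_confluentPow μ
  have hord' : ∀ u, confluentOrder μ u = 0 := fun u => by
    rw [confluentOrder, Finset.card_eq_zero, Finset.filter_eq_empty_iff]
    exact fun s hs => hinj u s hs
  simp only [confluentPow, hord'] at h2
  rw [← det_hasseDeriv_eval μ (fun _ => 0) (fun j => descPochhammer ℂ (n - 1 - (j : ℕ)))
    (fun j => monic_descPochhammer ℂ _) (fun j => descPochhammer_natDegree ℂ _)] at h2
  rw [h1, ← Matrix.det_mul_column, ← Matrix.det_transpose]
  trans ∏ i : Fin n, ∏ j ∈ Finset.Ioi i, if μ j = μ i then 1 else μ i - μ j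
  · rw [← h2]
    congr 1
    ext i j
    simp only [Matrix.transpose_apply, Matrix.of_apply, Polynomial.hasseDeriv_zero', hμ]
    rw [descPochhammer_eval_eq_descFactorial, Nat.descFactorial_eq_factorial_mul_choose]
    push_cast
    ring
  · refine Finset.prod_congr rfl fun i _ => Finset.prod_congr rfl fun j hj => ?_
    rw [if_neg (hinj i j hj)]
    simp only [hμ]
    have := j.2
    have := i.2
    push_cast [Nat.cast_sub (by omega : (j : ℕ) ≤ n - 1), Nat.cast_sub (by omega : (i : ℕ) ≤ n - 1)]
    ring

end confluent

/-! ### The Cauchy–Binet formula for infinite matrices. -/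

section cauchyBinet

theorem summable_norm_prod_and_hasSum {n : ℕ} (f : Fin n → ℕ → ℂ)
    (hf : ∀ i, Summable fun m => ‖f i m‖) :
    (Summable fun μ : Fin n → ℕ => ‖∏ i, f i (μ i)‖) ∧
      HasSum (fun μ : Fin n → ℕ => ∏ i, f i (μ i)) (∏ i, ∑' m, f i m) := by
  induction n with
  | zero => exact ⟨Summable.of_finite, by simp⟩
  | succ n ih =>
    obtain ⟨h1, h2⟩ := ih (fun i => f i.succ) fun i => hf i.succ
    have hs := (hf 0).mul_norm h1
    have key : ∀ z : ℕ × (Fin n → ℕ), ∏ i, f i (Fin.consEquiv (fun _ => ℕ) z i) =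
        f 0 z.1 * ∏ i : Fin n, f i.succ (z.2 i) := fun z => by
      simp [Fin.prod_univ_succ]
    constructor
    · rw [← (Fin.consEquiv fun _ => ℕ).summable_iff]
      refine hs.congr fun z => ?_
      rw [Function.comp_apply, key]
    · rw [← (Fin.consEquiv fun _ => ℕ).hasSum_iff, Fin.prod_univ_succ, ← h2.tsum_eq,
        tsum_mul_tsum_of_summable_norm (hf 0) h1]
      refine hs.of_norm.hasSum.congr_fun ?_
      exact fun z => key z

/-- The strictly decreasing vector attached to a partition. -/
def shiftedParts {n : ℕ} (κ : Fin n → ℕ) (j : Fin n) : ℕ :=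
  κ j + (n - 1 - (j : ℕ))

variable {n : ℕ}

theorem mem_partitionsOf {k : ℕ} {κ : Fin n → ℕ} :
    κ ∈ partitionsOf n k ↔ ∑ i, κ i = k ∧ ∀ i j : Fin n, i ≤ j → κ j ≤ κ i := by
  simp [partitionsOf]

theorem shiftedParts_strictAnti {κ : Fin n → ℕ} (hκ : ∀ i j : Fin n, i ≤ j → κ j ≤ κ i) :
    StrictAnti (shiftedParts κ) := by
  intro i j hij
  have h1 := hκ i j hij.le
  have h2 : (i : ℕ) < j := hij
  have := j.2
  simp only [shiftedParts]
  omega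

theorem shiftedParts_injective : Function.Injective (shiftedParts (n := n)) := by
  intro κ κ' h
  ext j
  have := congrFun h j
  simp only [shiftedParts] at this
  omega

theorem exists_shiftedParts_eq {μ : Fin n → ℕ} (hμ : StrictAnti μ) :
    ∃ κ : Fin n → ℕ, (∀ i j : Fin n, i ≤ j → κ j ≤ κ i) ∧ shiftedParts κ = μ := by
  -- A strictly decreasing vector drops by at least 1 per step, so the staircase can be subtracted
  -- and the remainder is still weakly decreasing.
  have key : ∀ k : ℕ, ∀ i j : Fin n, (j : ℕ) = i + k → μ j + k ≤ μ i := by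
    intro k
    induction k with
    | zero =>
      intro i j h
      rw [Fin.ext h]
      simp
    | succ k ih =>
      intro i j h
      have := j.2
      have h1 := ih i ⟨i + k, by omega⟩ rfl
      have h2 := hμ (show (⟨i + k, by omega⟩ : Fin n) < j from Fin.lt_def.2 (by simp; omega))
      omega
  have h1 : ∀ j : Fin n, n - 1 - (j : ℕ) ≤ μ j := fun j => by
    have := j.2
    have := key (n - 1 - j) j ⟨n - 1, by omega⟩ (by simp; omega)
    omega
  refine ⟨fun j => μ j - (n - 1 - j), fun i j hij => ?_, ?_⟩
  · have h2 : (i : ℕ) ≤ j := hij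
    have := key (j - i) i j (by omega)
    have := j.2
    simp only
    omega
  · ext j
    have := h1 j
    simp only [shiftedParts]
    omega

theorem exists_strictAnti_comp_perm {μ : Fin n → ℕ} (hμ : Function.Injective μ) :
    ∃ (ν : Fin n → ℕ) (τ : Equiv.Perm (Fin n)), StrictAnti ν ∧ ν ∘ τ = μ := by
  have h := Tuple.monotone_sort (OrderDual.toDual ∘ μ)
  set σ := Tuple.sort (OrderDual.toDual ∘ μ)
  refine ⟨μ ∘ σ, σ⁻¹, ?_, ?_⟩
  · refine Antitone.strictAnti_of_injective ?_ (hμ.comp σ.injective)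
    exact fun i j hij => h hij
  · ext i
    simp

/-- For each permutation a product of `n` absolutely convergent series is a series over all index
vectors `μ`; the finite signed sum over permutations then reassembles the determinant in `w`. -/
theorem hasSum_prod_mul_det {v w : Fin n → ℕ → ℂ}
    (h : ∀ i j, Summable fun m => ‖v i m * w j m‖) :
    HasSum (fun μ : Fin n → ℕ => (∏ i, v i (μ i)) * Matrix.det (Matrix.of fun i j => w j (μ i)))
      (Matrix.det (Matrix.of fun i j => ∑' m, v i m * w j m)) := by
  rw [← Matrix.det_transpose, Matrix.det_apply']
  have h1 : ∀ σ : Equiv.Perm (Fin n), HasSum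
      (fun μ : Fin n → ℕ => ((Equiv.Perm.sign σ : ℤ) : ℂ) * ∏ i, v i (μ i) * w (σ i) (μ i))
      (((Equiv.Perm.sign σ : ℤ) : ℂ) * ∏ i, ∑' m, v i m * w (σ i) m) := fun σ =>
    (summable_norm_prod_and_hasSum (fun i m => v i m * w (σ i) m) fun i => h i (σ i)).2.mul_left _
  refine (hasSum_sum fun σ (_ : σ ∈ Finset.univ) => h1 σ).congr_fun fun μ => ?_
  rw [← Matrix.det_transpose, Matrix.det_apply', Finset.mul_sum]
  refine Finset.sum_congr rfl fun σ _ => ?_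
  simp only [Matrix.transpose_apply, Matrix.of_apply, Finset.prod_mul_distrib]
  ring

/-- A vector `μ` with a repeated entry gives two equal rows and contributes nothing. Every other `μ`
is, in exactly one way, a permutation of the shifted parts of a partition; the signs from permuting
the rows of the `w`-minor sum the products of the `v` into the `v`-minor. -/
theorem hasSum_cauchyBinet_shiftedParts {v w : Fin n → ℕ → ℂ}
    (h : ∀ i j, Summable fun m => ‖v i m * w j m‖) :
    HasSum (fun p : Σ k : ℕ, partitionsOf n k =>
        Matrix.det (Matrix.of fun i j => v i (shiftedParts p.2.1 j)) *
          Matrix.det (Matrix.of fun i j => w j (shiftedParts p.2.1 i)))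
      (Matrix.det (Matrix.of fun i j => ∑' m, v i m * w j m)) := by
  let e : (Σ k : ℕ, partitionsOf n k) × Equiv.Perm (Fin n) → (Fin n → ℕ) :=
    fun z => shiftedParts z.1.2.1 ∘ z.2
  have hanti : ∀ p : (Σ k : ℕ, partitionsOf n k), StrictAnti (shiftedParts p.2.1) := fun p =>
    shiftedParts_strictAnti (mem_partitionsOf.1 p.2.2).2
  have he : Function.Injective e := by
    rintro ⟨⟨k, κ, hκ⟩, τ⟩ ⟨⟨k', κ', hκ'⟩, τ'⟩ heq
    have h1 := hanti ⟨k, κ, hκ⟩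
    have h2 := hanti ⟨k', κ', hκ'⟩
    simp only [e] at heq h1 h2
    -- A strictly decreasing vector is determined by its set of values.
    have h3 : Set.range (shiftedParts κ) = Set.range (shiftedParts κ') := by
      rw [← τ.surjective.range_comp, heq, τ'.surjective.range_comp]
    obtain rfl := shiftedParts_injective ((h1.range_inj h2).1 h3)
    have h4 : τ = τ' := Equiv.ext fun i => h1.injective (congrFun heq i)
    obtain rfl := (mem_partitionsOf.1 hκ).1
    obtain rfl := (mem_partitionsOf.1 hκ').1
    rw [h4]
  have hsum := hasSum_prod_mul_det h
  rw [← he.hasSum_iff] at hsum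
  · refine hsum.prod_fiberwise fun p => ?_
    have hfin := hasSum_fintype fun τ : Equiv.Perm (Fin n) =>
      (∏ i, v i (e (p, τ) i)) * Matrix.det (Matrix.of fun i j => w j (e (p, τ) i))
    convert! hfin using 1
    rw [Matrix.det_apply', Finset.sum_mul, ← Equiv.sum_comp (Equiv.inv (Equiv.Perm (Fin n)))]
    refine Finset.sum_congr rfl fun τ _ => ?_
    have hdet := Matrix.det_permute τ (Matrix.of fun i j => w j (shiftedParts p.2.1 i))
    simp only [Function.comp_apply, e]
    have : (Matrix.of fun i j => w j (shiftedParts p.2.1 (τ i))) =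
        (Matrix.of fun i j => w j (shiftedParts p.2.1 i)).submatrix τ id := rfl
    rw [this, hdet, ← Equiv.prod_comp τ]
    simp
    ring
  · intro μ hμ
    have hninj : ¬ Function.Injective μ := fun hinj => hμ <| by
      obtain ⟨ν, τ, hν, rfl⟩ := exists_strictAnti_comp_perm hinj
      obtain ⟨κ, hκ, rfl⟩ := exists_shiftedParts_eq hν
      exact ⟨(⟨∑ i, κ i, κ, mem_partitionsOf.2 ⟨rfl, hκ⟩⟩, τ), rfl⟩
    simp only [Function.Injective, not_forall] at hninj
    obtain ⟨i, j, hij, hne⟩ := hninj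
    rw [Matrix.det_zero_of_row_eq hne (by ext l; simp [hij]), mul_zero]

/-- The Cauchy–Binet formula for two infinite matrices with `n` rows, with the minors grouped by
the size of the partitions that index them. -/
theorem hasSum_cauchyBinet {v w : Fin n → ℕ → ℂ}
    (h : ∀ i j, Summable fun m => ‖v i m * w j m‖) :
    HasSum (fun k : ℕ => ∑ κ ∈ partitionsOf n k,
        Matrix.det (Matrix.of fun i j => v i (shiftedParts κ j)) *
          Matrix.det (Matrix.of fun i j => w j (shiftedParts κ i)))
      (Matrix.det (Matrix.of fun i j => ∑' m, v i m * w j m)) :=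
  (hasSum_cauchyBinet_shiftedParts h).sigma fun k =>
    Finset.hasSum (partitionsOf n k) fun κ =>
      Matrix.det (Matrix.of fun i j => v i (shiftedParts κ j)) *
        Matrix.det (Matrix.of fun i j => w j (shiftedParts κ i))

end cauchyBinet

/-! ### The matrix series as a sum over Schur polynomials. -/

section term

theorem pochhammer_add (z : ℂ) (k m : ℕ) :
    pochhammer z (k + m) = pochhammer z k * pochhammer (z + k) m := by
  simp [pochhammer, ← ascPochhammer_mul]

variable {n p q : ℕ}

/-- The coefficients of the scalar hypergeometric series with parameters `a`, `b`. -/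
def pfqCoeff (a : Fin p → ℂ) (b : Fin q → ℂ) (m : ℕ) : ℂ :=
  1 / (m ! : ℂ) * ((∏ j, pochhammer (a j) m) / ∏ j, pochhammer (b j) m)

/-- Since `(c - n + 1) + (n - 1 - i) = c - i`, the symbol in row `i` continues the symbol that
starts at `c - n + 1`. All rows then share one base, so the coefficient factors over the shifted
parts. -/
theorem prod_pochhammer_mul_pochhammerPartition (c : ℂ) (κ : Fin n → ℕ) :
    (∏ i : Fin n, pochhammer (c - n + 1) (n - 1 - (i : ℕ))) * pochhammerPartition c κ =
      ∏ i : Fin n, pochhammer (c - n + 1) (shiftedParts κ i) := by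
  rw [pochhammerPartition, ← Finset.prod_mul_distrib]
  refine Finset.prod_congr rfl fun i _ => ?_
  have := i.2
  rw [shiftedParts, Nat.add_comm (κ i), pochhammer_add]
  congr 2
  rw [Nat.cast_sub (by omega), Nat.cast_sub (by omega)]
  push_cast
  ring

theorem prod_pfqCoeff_mul_pochhammerPartition (a : Fin p → ℂ) (b : Fin q → ℂ) (κ : Fin n → ℕ) :
    (∏ i : Fin n, pfqCoeff (fun u => a u - n + 1) (fun v => b v - n + 1) (n - 1 - (i : ℕ))) *
      ((∏ j, pochhammerPartition (a j) κ) / ∏ j, pochhammerPartition (b j) κ) =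
    (∏ i : Fin n, ((shiftedParts κ i)! : ℂ)) / (∏ i : Fin n, ((n - 1 - (i : ℕ))! : ℂ)) *
      ∏ i : Fin n, pfqCoeff (fun u => a u - n + 1) (fun v => b v - n + 1) (shiftedParts κ i) := by
  have h1 : ∏ i : Fin n, ((shiftedParts κ i)! : ℂ) ≠ 0 :=
    Finset.prod_ne_zero_iff.2 fun i _ => by exact_mod_cast Nat.factorial_ne_zero _
  simp only [pfqCoeff, Finset.prod_mul_distrib, Finset.prod_div_distrib, Finset.prod_const_one]
  rw [Finset.prod_comm, Finset.prod_comm (f := fun (i : Fin n) v => pochhammer (b v - n + 1) _),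
    Finset.prod_comm (f := fun (i : Fin n) u => pochhammer (a u - n + 1) (shiftedParts κ i)),
    Finset.prod_comm (f := fun (i : Fin n) v => pochhammer (b v - n + 1) (shiftedParts κ i))]
  simp only [← prod_pochhammer_mul_pochhammerPartition, Finset.prod_mul_distrib]
  field_simp

theorem prod_sub_ne_zero {κ : Fin n → ℕ} (hκ : ∀ i j : Fin n, i ≤ j → κ j ≤ κ i) :
    ∏ i : Fin n, ∏ j ∈ Finset.Ioi i, ((κ i : ℂ) - κ j - (i : ℕ) + (j : ℕ)) ≠ 0 := by
  refine Finset.prod_ne_zero_iff.2 fun i _ => Finset.prod_ne_zero_iff.2 fun j hj => ?_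
  have h1 : i < j := Finset.mem_Ioi.1 hj
  have h2 := hκ i j h1.le
  have h3 : (i : ℕ) < j := h1
  intro h
  have : ((κ i + (j : ℕ) : ℕ) : ℂ) = ((κ j + (i : ℕ) : ℕ) : ℂ) := by
    push_cast
    linear_combination h
  have := Nat.cast_injective this
  omega

/-- One factor `symmetricGroupDim κ` survives the quotient; `k!` cancels its factorial, and the Weyl
dimension formula trades its product of differences for `s_κ(1, …, 1)`, which cancels the
denominator. -/
theorem zonal_mul_zonal_div {k : ℕ} {κ : Fin n → ℕ} (hκ : κ ∈ partitionsOf n k)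
    (x y : Fin n → ℂ) :
    1 / (k ! : ℂ) * (zonal κ x * zonal κ y / zonal κ (fun _ => 1)) =
      (∏ i : Fin n, ((n - 1 - (i : ℕ))! : ℂ)) / (∏ i : Fin n, ((shiftedParts κ i)! : ℂ)) *
        (schur κ x * schur κ y) := by
  obtain ⟨rfl, hanti⟩ := mem_partitionsOf.1 hκ
  have h1 := prod_factorial_mul_schur_one κ hanti
  have h2 := prod_sub_ne_zero hanti
  simp only [zonal, symmetricGroupDim]
  rw [← h1] at h2 ⊢
  have h3 := left_ne_zero_of_mul h2
  have h4 := right_ne_zero_of_mul h2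
  have h5 : ∏ i : Fin n, ((shiftedParts κ i)! : ℂ) ≠ 0 :=
    Finset.prod_ne_zero_iff.2 fun i _ => by exact_mod_cast Nat.factorial_ne_zero _
  have h6 : ((∑ i, κ i)! : ℂ) ≠ 0 := by exact_mod_cast Nat.factorial_ne_zero _
  simp only [shiftedParts] at h5 ⊢
  field_simp

theorem matrixPFQTerm_mul_prod (a : Fin p → ℂ) (b : Fin q → ℂ) (x y : Fin n → ℂ) (k : ℕ) :
    matrixPFQTerm a b x y k *
      ∏ i : Fin n, pfqCoeff (fun u => a u - n + 1) (fun v => b v - n + 1) (n - 1 - (i : ℕ)) =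
    ∑ κ ∈ partitionsOf n k,
      (∏ i : Fin n, pfqCoeff (fun u => a u - n + 1) (fun v => b v - n + 1) (shiftedParts κ i)) *
        (schur κ x * schur κ y) := by
  rw [matrixPFQTerm, Finset.mul_sum, Finset.sum_mul]
  refine Finset.sum_congr rfl fun κ hκ => ?_
  have h1 := prod_pfqCoeff_mul_pochhammerPartition a b κ
  have h2 := zonal_mul_zonal_div hκ x y
  have h5 : ∏ i : Fin n, ((shiftedParts κ i)! : ℂ) ≠ 0 :=
    Finset.prod_ne_zero_iff.2 fun i _ => by exact_mod_cast Nat.factorial_ne_zero _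
  have h6 : ∏ i : Fin n, ((n - 1 - (i : ℕ))! : ℂ) ≠ 0 :=
    Finset.prod_ne_zero_iff.2 fun i _ => by exact_mod_cast Nat.factorial_ne_zero _
  rw [mul_left_comm, h2, mul_right_comm, mul_comm ((_ : ℂ) / _) (∏ i : Fin n, pfqCoeff _ _ _), h1]
  field_simp

/-- The determinant formula for the hypergeometric function of two matrix arguments, for
arguments that need not be distinct. -/
theorem hasSum_matrixPFQTerm (a : Fin p → ℂ) (b : Fin q → ℂ) (x y : Fin n → ℂ)
    (h : ∀ i j : Fin n, Summable fun m : ℕ =>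
      ‖pfqCoeff (fun u => a u - n + 1) (fun v => b v - n + 1) m * confluentPow x i m *
        completeHomogeneous y ((m : ℤ) - n + 1 + (j : ℕ))‖) :
    HasSum (fun k => matrixPFQTerm a b x y k *
        ((∏ i : Fin n, pfqCoeff (fun u => a u - n + 1) (fun v => b v - n + 1) (n - 1 - (i : ℕ))) *
          Matrix.det (Matrix.of fun i j : Fin n => confluentPow x i (n - 1 - (j : ℕ)))))
      (Matrix.det (Matrix.of fun i j : Fin n => ∑' m : ℕ,
        pfqCoeff (fun u => a u - n + 1) (fun v => b v - n + 1) m * confluentPow x i m *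
          completeHomogeneous y ((m : ℤ) - n + 1 + (j : ℕ)))) := by
  -- The coefficients `c_m` go into the rows for `x`, where the bialternant formula applies; the
  -- rows for `y` give a Jacobi–Trudi determinant, because `μ_i - n + 1 + j = κ_i - i + j`.
  refine (hasSum_cauchyBinet (w := fun j m => completeHomogeneous y ((m : ℤ) - n + 1 + (j : ℕ)))
    h).congr_fun fun k => ?_
  rw [← mul_assoc, matrixPFQTerm_mul_prod, Finset.sum_mul]
  refine Finset.sum_congr rfl fun κ _ => ?_
  have h1 := Matrix.det_mul_row
    (fun j => pfqCoeff (fun u => a u - n + 1) (fun v => b v - n + 1) (shiftedParts κ j))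
    (Matrix.of fun i j : Fin n => confluentPow x i (shiftedParts κ j))
  simp only [Matrix.of_apply] at h1
  rw [h1, show (Matrix.of fun i j : Fin n => confluentPow x i (shiftedParts κ j)).det = _ from
    (schur_mul_confluent_alternant κ x).symm, schur]
  have h2 : (Matrix.of fun i j : Fin n => completeHomogeneous y
      ((shiftedParts κ i : ℤ) - n + 1 + (j : ℕ))) = Matrix.of fun i j : Fin n =>
      completeHomogeneous y ((κ i : ℤ) - ((i : ℕ) : ℤ) + ((j : ℕ) : ℤ)) := by
    ext i j
    have := i.2
    simp only [Matrix.of_apply, shiftedParts]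
    congr 1
    omega
  rw [h2, ← schur, ← schur]
  simp only [mul_assoc, mul_comm, mul_left_comm]

end term

/-! ### Convergence of the scalar series and its contour integrals. -/

section scalar

open Filter Topology

variable {n p q : ℕ}

theorem pochhammer_succ (z : ℂ) (k : ℕ) : pochhammer z (k + 1) = pochhammer z k * (z + k) :=
  ascPochhammer_succ_eval k z

theorem pochhammer_ne_zero {z : ℂ} {k : ℕ} (h : ∀ i < k, z + i ≠ 0) : pochhammer z k ≠ 0 := by
  induction k with
  | zero => simp [pochhammer]
  | succ k ih =>
    rw [pochhammer_succ]
    exact mul_ne_zero (ih fun i hi => h i (by omega)) (h k (by omega))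

theorem pochhammer_neg_natCast {m k : ℕ} (h : m < k) : pochhammer (-(m : ℂ)) k = 0 := by
  obtain ⟨c, rfl⟩ := Nat.exists_eq_add_of_lt h
  rw [add_assoc, add_comm c, ← add_assoc, pochhammer_add, pochhammer_succ]
  simp

theorem pfqCoeff_succ (a : Fin p → ℂ) (b : Fin q → ℂ) (m : ℕ) :
    pfqCoeff a b (m + 1) = pfqCoeff a b m * (((m : ℂ) + 1)⁻¹ * (∏ j, (a j + m)) *
      ∏ j, (b j + m)⁻¹) := by
  simp only [pfqCoeff, pochhammer_succ, Finset.prod_mul_distrib, Nat.factorial_succ,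
    Finset.prod_inv_distrib]
  push_cast
  rw [one_div, mul_inv, div_eq_mul_inv, mul_inv]
  ring

/-- Coefficient form of the rule that the `d`-th derivative of a hypergeometric series is a multiple
of the series with all parameters raised by `d`. -/
theorem pfqCoeff_add (a : Fin p → ℂ) (b : Fin q → ℂ) (d m : ℕ) :
    pfqCoeff a b (m + d) * ((m + d).choose d : ℂ) =
      pfqCoeff a b d * pfqCoeff (fun j => a j + d) (fun j => b j + d) m := by
  have h1 : (((m + d)! : ℕ) : ℂ) ≠ 0 := by exact_mod_cast Nat.factorial_ne_zero _
  have h2 : ((m ! : ℕ) : ℂ) ≠ 0 := by exact_mod_cast Nat.factorial_ne_zero _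
  have h3 : ((d ! : ℕ) : ℂ) ≠ 0 := by exact_mod_cast Nat.factorial_ne_zero _
  have hc : ((m + d).choose d : ℂ) * (d ! : ℂ) * (m ! : ℂ) = ((m + d)! : ℂ) := by
    rw [mul_right_comm]
    exact_mod_cast Nat.add_choose_mul_factorial_mul_factorial m d
  rw [← hc] at h1
  have h4 := left_ne_zero_of_mul (left_ne_zero_of_mul h1)
  simp only [pfqCoeff]
  rw [← hc]
  rw [add_comm m d]
  simp only [pochhammer_add, Finset.prod_mul_distrib]
  rw [add_comm d m]
  field_simp

theorem tendsto_add_natCast_div (c : ℂ) :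
    Tendsto (fun m : ℕ => (c + m) / ((m : ℂ) + 1)) atTop (𝓝 1) := by
  have h := ((tendsto_one_div_add_atTop_nhds_zero_nat (𝕜 := ℂ)).const_mul (c - 1)).const_add 1
  rw [mul_zero, add_zero] at h
  refine h.congr fun m => ?_
  have : (m : ℂ) + 1 ≠ 0 := by exact_mod_cast m.succ_ne_zero
  field_simp
  ring

/-- The limit `0 ^ (q + 1 - p)` covers both regimes: it is 0 for `p ≤ q`, and `0 ^ 0 = 1` for `p = q
+ 1`. -/
theorem tendsto_pfqCoeff_ratio (a : Fin p → ℂ) (b : Fin q → ℂ) (hpq : p ≤ q + 1) :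
    Tendsto (fun m : ℕ => ((m : ℂ) + 1)⁻¹ * (∏ j, (a j + m)) * ∏ j, (b j + m)⁻¹) atTop
      (𝓝 (0 ^ (q + 1 - p))) := by
  have h1 := tendsto_finsetProd Finset.univ fun j _ => tendsto_add_natCast_div (a j)
  have h2 := tendsto_finsetProd Finset.univ fun j _ =>
    (tendsto_add_natCast_div (b j)).inv₀ one_ne_zero
  have h3 := (tendsto_one_div_add_atTop_nhds_zero_nat (𝕜 := ℂ)).pow (q + 1 - p)
  have h := (h3.mul h1).mul h2
  simp only [Finset.prod_const_one, inv_one, mul_one] at h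
  refine h.congr fun m => ?_
  have hm : (m : ℂ) + 1 ≠ 0 := by exact_mod_cast m.succ_ne_zero
  simp only [Finset.prod_div_distrib, inv_div, Finset.prod_const, Finset.card_univ,
    Fintype.card_fin, Finset.prod_inv_distrib, one_div, inv_pow]
  have hp : ((m : ℂ) + 1) ^ (q + 1 - p) * ((m : ℂ) + 1) ^ p = ((m : ℂ) + 1) ^ q * ((m : ℂ) + 1) := by
    rw [← pow_add, ← pow_succ]
    congr 1
    omega
  have hm1 : ((m : ℂ) + 1) ^ (q + 1 - p) ≠ 0 := pow_ne_zero _ hm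
  have hm2 : ((m : ℂ) + 1) ^ p ≠ 0 := pow_ne_zero _ hm
  have hm3 : ((m : ℂ) + 1) ^ q ≠ 0 := pow_ne_zero _ hm
  rw [show ((m : ℂ) + 1)⁻¹ = ((m : ℂ) + 1) ^ q * ((((m : ℂ) + 1) ^ (q + 1 - p)) *
    ((m : ℂ) + 1) ^ p)⁻¹ by rw [hp, mul_inv, ← mul_assoc, mul_inv_cancel₀ hm3, one_mul]]
  rw [mul_inv, div_eq_mul_inv, div_eq_mul_inv]
  ring

theorem pfqCoeff_eq_zero {a : Fin p → ℂ} (b : Fin q → ℂ) {i : Fin p} {k m : ℕ}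
    (ha : a i = -(k : ℂ)) (hm : k < m) : pfqCoeff a b m = 0 := by
  rw [pfqCoeff, Finset.prod_eq_zero (Finset.mem_univ i) (by rw [ha, pochhammer_neg_natCast hm])]
  simp

theorem summable_norm_pfqCoeff_mul_pow (a : Fin p → ℂ) (b : Fin q → ℂ) {ρ : ℝ} (hρ : 0 ≤ ρ)
    (h : p ≤ q ∨ (∃ (i : Fin p) (m : ℕ), a i = -(m : ℂ)) ∨ (p = q + 1 ∧ ρ < 1)) :
    Summable fun m => ‖pfqCoeff a b m‖ * ρ ^ m := by
  have key : p ≤ q + 1 → ‖(0 : ℂ) ^ (q + 1 - p)‖ * ρ < 1 →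
      Summable fun m => ‖pfqCoeff a b m‖ * ρ ^ m := fun hpq hlt => by
    obtain ⟨r, hr1, hr2⟩ := exists_between hlt
    refine summable_of_ratio_norm_eventually_le hr2 ?_
    have ht := ((tendsto_pfqCoeff_ratio a b hpq).norm.mul_const ρ).eventually_le_const hr1
    filter_upwards [ht] with m hm
    have h0 : 0 ≤ ‖pfqCoeff a b m‖ * ρ ^ m := by positivity
    have h1 : 0 ≤ ‖pfqCoeff a b (m + 1)‖ * ρ ^ (m + 1) := by positivity
    rw [Real.norm_of_nonneg h0, Real.norm_of_nonneg h1, pfqCoeff_succ, norm_mul, pow_succ]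
    calc _ = _ * ρ * (‖pfqCoeff a b m‖ * ρ ^ m) := by ring
      _ ≤ _ := mul_le_mul_of_nonneg_right hm h0
  rcases h with h | ⟨i, k, h⟩ | ⟨rfl, h⟩
  · refine key (by omega) ?_
    rw [zero_pow (by omega)]
    simp
  · refine summable_of_ne_finset_zero (s := Finset.range (k + 1)) fun m hm => ?_
    rw [pfqCoeff_eq_zero b h (by simpa using hm)]
    simp
  · exact key le_rfl (by simpa using h)

theorem scalarPFQ_eq_tsum (a : Fin p → ℂ) (b : Fin q → ℂ) (z : ℂ) :
    scalarPFQ a b z = ∑' m, pfqCoeff a b m * z ^ m :=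
  rfl

variable {z₀ : ℂ} {γ : Path z₀ z₀}

/-- The contour integrals in the determinant, expanded into series. -/
theorem IsContour.hasSum_scalarPFQ (hγ : IsContour γ) {y : Fin n → ℂ}
    (hy : ∀ s, Encloses γ (y s)) (a : Fin p → ℂ) (b : Fin q → ℂ) (w : ℂ) (l : ℕ)
    (h : p ≤ q ∨ (∃ (i : Fin p) (m : ℕ), a i = -(m : ℂ)) ∨
      (p = q + 1 ∧ ∀ t, ‖w‖ * ‖γ t‖ < 1)) :
    HasSum (fun m : ℕ => pfqCoeff a b m * w ^ m *
        completeHomogeneous y (((m + l : ℕ) : ℤ) + 1 - n))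
      (1 / (2 * Real.pi * Complex.I) * contourIntegral γ fun z =>
        scalarPFQ a b (w * z) * z ^ l / ∏ s, (z - y s)) := by
  have hcomp : IsCompact (Set.range γ) := isCompact_range γ.continuous
  -- By compactness `|γ|` attains its maximum, so one radius, below 1 when `p = q + 1`, dominates
  -- the series on the whole contour.
  obtain ⟨t₀, -, ht₀⟩ := isCompact_univ.exists_isMaxOn Set.univ_nonempty
    (γ.continuous.norm.continuousOn (s := Set.univ))
  have hmax : ∀ z ∈ Set.range γ, ‖w * z‖ ≤ ‖w‖ * ‖γ t₀‖ := by
    rintro _ ⟨t, rfl⟩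
    rw [norm_mul]
    exact mul_le_mul_of_nonneg_left (ht₀ (Set.mem_univ t)) (norm_nonneg _)
  have hsum := summable_norm_pfqCoeff_mul_pow a b
    (mul_nonneg (norm_nonneg w) (norm_nonneg (γ t₀)))
    (h.imp_right (Or.imp_right (And.imp_right fun h => h t₀)))
  obtain ⟨D, hD⟩ := hcomp.exists_bound_of_continuousOn
    (continuousOn_pow_div_prod hy Finset.univ l)
  have hterm : ∀ z ∈ Set.range γ, ∀ m,
      ‖pfqCoeff a b m * (w * z) ^ m‖ ≤ ‖pfqCoeff a b m‖ * (‖w‖ * ‖γ t₀‖) ^ m := fun z hz m => by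
    rw [norm_mul, norm_pow]
    exact mul_le_mul_of_nonneg_left (pow_le_pow_left₀ (norm_nonneg _) (hmax z hz) m)
      (norm_nonneg _)
  have key := hγ.hasSum_contourIntegral
    (F := fun m z => pfqCoeff a b m * w ^ m * (z ^ (m + l) / ∏ s, (z - y s)))
    (f := fun z => scalarPFQ a b (w * z) * z ^ l / ∏ s, (z - y s))
    (u := fun m => ‖pfqCoeff a b m‖ * (‖w‖ * ‖γ t₀‖) ^ m * D)
    (fun m => continuousOn_const.mul (continuousOn_pow_div_prod hy Finset.univ (m + l)))
    (hsum.mul_right D) (fun m z hz => ?_) (fun z hz => ?_)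
  · refine (key.mul_left (1 / (2 * Real.pi * Complex.I))).congr_fun fun m => ?_
    rw [contourIntegral_const_mul, mul_left_comm, hγ.contourIntegral_pow_div_prod_univ hy]
  · have h1 := mul_le_mul (hterm z hz m) (hD z hz) (norm_nonneg _) (by positivity)
    rw [← norm_mul] at h1
    refine le_of_eq_of_le (congrArg _ ?_) h1
    rw [mul_pow, pow_add]
    ring
  · have h1 : Summable fun m => pfqCoeff a b m * (w * z) ^ m :=
      Summable.of_norm_bounded hsum (hterm z hz)
    have h2 := h1.hasSum.mul_right (z ^ l / ∏ s, (z - y s))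
    rw [← scalarPFQ_eq_tsum, ← mul_div_assoc] at h2
    refine h2.congr_fun fun m => ?_
    rw [mul_pow, pow_add]
    ring

/-- The series in the entries of the determinant, expressed by contour integrals. -/
theorem IsContour.hasSum_confluentPow (hγ : IsContour γ) {y : Fin n → ℂ}
    (hy : ∀ s, Encloses γ (y s)) (a : Fin p → ℂ) (b : Fin q → ℂ) (x : Fin n → ℂ)
    (h : p ≤ q ∨ (∃ (i : Fin p) (m : ℕ), a i = -(m : ℂ)) ∨
      (p = q + 1 ∧ ∀ j t, ‖x j‖ * ‖γ t‖ < 1)) (i j : Fin n) :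
    HasSum (fun m : ℕ => pfqCoeff (fun u => a u - n + 1) (fun v => b v - n + 1) m *
        confluentPow x i m * completeHomogeneous y ((m : ℤ) - n + 1 + (j : ℕ)))
      (pfqCoeff (fun u => a u - n + 1) (fun v => b v - n + 1) (confluentOrder x i) *
        (1 / (2 * Real.pi * Complex.I) * contourIntegral γ fun z =>
          scalarPFQ (fun u => a u - n + 1 + confluentOrder x i)
            (fun v => b v - n + 1 + confluentOrder x i) (x i * z) *
            z ^ (confluentOrder x i + j) / ∏ s, (z - y s))) := by
  have hd := confluentOrder_lt x i
  set d := confluentOrder x i with hdd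
  have h1 := (hγ.hasSum_scalarPFQ hy (fun u => a u - n + 1 + d) (fun v => b v - n + 1 + d) (x i)
    (d + j) ?_).mul_left (pfqCoeff (fun u => a u - n + 1) (fun v => b v - n + 1) d)
  · rw [← (add_left_injective d).hasSum_iff]
    · refine h1.congr_fun fun m => ?_
      have h2 := pfqCoeff_add (fun u => a u - n + 1) (fun v => b v - n + 1) d m
      simp only [Function.comp_apply, confluentPow, ← hdd, Nat.add_sub_cancel]
      rw [← mul_assoc, ← mul_assoc, ← mul_assoc, h2]
      congr 2
      push_cast
      ring
    · intro m hm
      have : m < d := by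
        by_contra hlt
        exact hm ⟨m - d, by simp; omega⟩
      simp [confluentPow, ← hdd, Nat.choose_eq_zero_of_lt this]
  · refine h.imp_right (Or.imp ?_ (And.imp_right fun h => h i))
    rintro ⟨u, m, hu⟩
    -- The shifted parameter `a_u - n + 1 + d` is still a nonpositive integer, because `d ≤ n - 1`.
    refine ⟨u, m + (n - 1 - d), ?_⟩
    rw [hu]
    push_cast [Nat.cast_sub (by omega : d ≤ n - 1), Nat.cast_sub (by omega : 1 ≤ n)]
    ring

end scalar

/-! ### Block structure of `x` and the constants of the formula. -/

section blocks

variable {p q r s : ℕ} (c : Composition r)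

theorem lt_of_index_lt {v w : Fin r} (h : c.index v < c.index w) : v < w := by
  have h1 := c.lt_sizeUpTo_index_succ v
  have h2 := c.sizeUpTo_index_le w
  have h3 : (c.index v).succ ≤ (c.index w : ℕ) := h
  exact Fin.lt_def.2 (h1.trans_le ((c.monotone_sizeUpTo h3).trans h2))

theorem index_lt_index_iff {v w : Fin r} : c.index v < c.index w ↔ v < w ∧ c.index v ≠ c.index w :=
  ⟨fun h => ⟨lt_of_index_lt c h, h.ne⟩, fun h =>
    lt_of_le_of_ne (not_lt.1 fun h' => (lt_of_index_lt c h').not_gt h.1) h.2⟩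

theorem prod_index_invEmbedding {M : Type*} [CommMonoid M] (f : Fin c.length → ℕ → M) :
    ∏ v, f (c.index v) (c.invEmbedding v) = ∏ l, ∏ i : Fin (c.blocksFun l), f l i := by
  rw [← c.blocksFinEquiv.prod_comp, Fintype.prod_sigma]
  refine Finset.prod_congr rfl fun l _ => Finset.prod_congr rfl fun i _ => ?_
  have h1 : c.blocksFinEquiv ⟨l, i⟩ = c.embedding l i := rfl
  rw [h1, c.invEmbedding_comp, c.index_embedding]

theorem prod_index {M : Type*} [CommMonoid M] (f : Fin c.length → M) :
    ∏ v, f (c.index v) = ∏ l, f l ^ c.blocksFun l := by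
  rw [prod_index_invEmbedding c fun l _ => f l]
  simp

variable {c} {ξ : Fin c.length → ℂ} {x : Fin (r + s) → ℂ}

/-- Equal later coordinates can only lie in the same block: different blocks carry different values,
and the tail is zero while the values are not. With rows counted from 1 the order is the `k - i` of
the block entries. -/
theorem confluentOrder_castAdd (hξ : Function.Injective ξ) (hξ0 : ∀ l, ξ l ≠ 0)
    (hx : ∀ v, x (Fin.castAdd s v) = ξ (c.index v)) (hx0 : ∀ w, x (Fin.natAdd r w) = 0)
    (v : Fin r) :
    confluentOrder x (Fin.castAdd s v) =
      c.blocksFun (c.index v) - ((c.invEmbedding v : ℕ) + 1) := by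
  have hset : (Finset.Ioi (Fin.castAdd s v)).filter (fun t => x t = x (Fin.castAdd s v)) =
      (Finset.Ioi (c.invEmbedding v)).map
        ((c.embedding (c.index v)).toEmbedding.trans (Fin.castAddEmb s)) := by
    ext t
    simp only [Finset.mem_filter, Finset.mem_Ioi, Finset.mem_map, Function.Embedding.trans_apply,
      RelEmbedding.coe_toEmbedding, Fin.castAddEmb_apply]
    constructor
    · rintro ⟨h1, h2⟩
      induction t using Fin.addCases with
      | left w =>
        rw [hx, hx] at h2
        have h3 := hξ h2
        have h4 : v < w := h1
        obtain ⟨i, rfl⟩ := (c.mem_range_embedding_iff' (j := w)).2 h3.symm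
        refine ⟨i, ?_, rfl⟩
        rw [← (c.embedding (c.index v)).lt_iff_lt, c.embedding_comp_inv]
        exact h4
      | right w =>
        rw [hx0, hx] at h2
        exact absurd h2.symm (hξ0 _)
    · rintro ⟨i, hi, rfl⟩
      rw [← (c.embedding (c.index v)).lt_iff_lt, c.embedding_comp_inv] at hi
      exact ⟨hi, by rw [hx, hx, c.index_embedding]⟩
  rw [confluentOrder, hset, Finset.card_map, Fin.card_Ioi]
  omega

theorem confluentOrder_natAdd (hx0 : ∀ w, x (Fin.natAdd r w) = 0) (w : Fin s) :
    confluentOrder x (Fin.natAdd r w) = s - 1 - (w : ℕ) := by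
  rw [confluentOrder, Finset.filter_true_of_mem, Fin.card_Ioi]
  · simp
    omega
  · intro t ht
    have h1 : Fin.natAdd r w < t := Finset.mem_Ioi.1 ht
    induction t using Fin.addCases with
    | left v =>
      have h2 : r + (w : ℕ) < v := h1
      have := v.2
      omega
    | right w' => rw [hx0, hx0]

/-- Pairs inside a block or inside the zero tail contribute 1, two blocks contribute one factor for
each of their `k_i k_j` pairs, and each nonzero coordinate meets `s` zeros. -/
theorem prod_sub_eq_prod_blocks (hξ : Function.Injective ξ) (hξ0 : ∀ l, ξ l ≠ 0)
    (hx : ∀ v, x (Fin.castAdd s v) = ξ (c.index v)) (hx0 : ∀ w, x (Fin.natAdd r w) = 0) :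
    (∏ i, ∏ j ∈ Finset.Ioi i, if x j = x i then 1 else x i - x j) =
      (∏ i, ∏ j ∈ Finset.Ioi i, (ξ i - ξ j) ^ (c.blocksFun i * c.blocksFun j)) *
        ∏ l, ξ l ^ (c.blocksFun l * s) := by
  -- Indicator products over all indices can be split at `r` and regrouped by blocks, unlike
  -- products over `Ioi`.
  have hIoi : ∀ {m : ℕ} (i : Fin m) (f : Fin m → ℂ),
      ∏ j ∈ Finset.Ioi i, f j = ∏ j, if i < j then f j else 1 := fun i f => by
    rw [← Finset.prod_filter]
    congr 1
    ext
    simp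
  have h1 : ∀ v w : Fin r, (if Fin.castAdd s v < Fin.castAdd s w then
      (if x (Fin.castAdd s w) = x (Fin.castAdd s v) then 1 else
        x (Fin.castAdd s v) - x (Fin.castAdd s w)) else 1) =
      if c.index v < c.index w then ξ (c.index v) - ξ (c.index w) else 1 := fun v w => by
    rw [hx, hx]
    have hlt : Fin.castAdd s v < Fin.castAdd s w ↔ v < w := Iff.rfl
    simp only [hlt, hξ.eq_iff, index_lt_index_iff]
    by_cases hi : c.index v = c.index w
    · simp [hi]
    · simp [hi, Ne.symm hi]
  have h2 : ∀ (v : Fin r) (w : Fin s), (if Fin.castAdd s v < Fin.natAdd r w then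
      (if x (Fin.natAdd r w) = x (Fin.castAdd s v) then 1 else
        x (Fin.castAdd s v) - x (Fin.natAdd r w)) else 1) = ξ (c.index v) := fun v w => by
    have hlt : Fin.castAdd s v < Fin.natAdd r w := Fin.lt_def.2 (by simp; omega)
    rw [hx, hx0, if_pos hlt, if_neg (hξ0 _).symm, sub_zero]
  have h3 : ∀ (w : Fin s) (t : Fin (r + s)), (if Fin.natAdd r w < t then
      (if x t = x (Fin.natAdd r w) then 1 else x (Fin.natAdd r w) - x t) else 1) = 1 := by
    intro w t
    split_ifs with h h' <;> try rfl
    exfalso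
    induction t using Fin.addCases with
    | left v =>
      have h4 : r + (w : ℕ) < v := h
      have := v.2
      omega
    | right w' => exact h' (by rw [hx0, hx0])
  simp only [hIoi]
  rw [Fin.prod_univ_add]
  simp only [h3, Finset.prod_const_one, mul_one]
  simp only [Fin.prod_univ_add, h1, h2, Finset.prod_mul_distrib, Finset.prod_const,
    Finset.card_univ, Fintype.card_fin]
  congr 1
  · rw [prod_index c fun l => ∏ w, if l < c.index w then ξ l - ξ (c.index w) else 1]
    refine Finset.prod_congr rfl fun l _ => ?_
    rw [prod_index c fun l' => if l < l' then ξ l - ξ l' else 1, ← Finset.prod_pow]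
    refine Finset.prod_congr rfl fun l' _ => ?_
    split_ifs
    · rw [← pow_mul, mul_comm]
    · simp
  · rw [prod_index c fun l => ξ l ^ s]
    refine Finset.prod_congr rfl fun l _ => ?_
    rw [← pow_mul, mul_comm]

variable {n : ℕ}

theorem prod_pfqCoeff_range (a : Fin p → ℂ) (b : Fin q → ℂ) {k : ℕ} (hk : 1 ≤ k) :
    ∏ i : Fin k, pfqCoeff (fun u => a u - n + 1) (fun v => b v - n + 1) (k - ((i : ℕ) + 1)) =
      constKMult n k a b := by
  obtain ⟨k, rfl⟩ := Nat.exists_eq_add_of_le' hk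
  rw [Fin.prod_univ_eq_prod_range
    (fun i => pfqCoeff (fun u => a u - n + 1) (fun v => b v - n + 1) (k + 1 - (i + 1)))]
  have h1 : ∀ i, k + 1 - (i + 1) = k + 1 - 1 - i := fun i => by omega
  rw [Finset.prod_congr rfl fun i _ => congrArg _ (h1 i)]
  rw [Finset.prod_range_reflect, Finset.prod_range_succ', constKMult, Nat.add_sub_cancel,
    ← Finset.Ico_add_one_right_eq_Icc, Finset.prod_Ico_eq_prod_range, Nat.add_sub_cancel]
  have h0 : pfqCoeff (fun u => a u - n + 1) (fun v => b v - n + 1) 0 = 1 := by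
    simp [pfqCoeff, pochhammer]
  rw [h0, mul_one]
  simp only [pfqCoeff, Finset.prod_mul_distrib, add_comm 1]
  congr 1
  -- The constant pairs `1/(k-j)!` with Pochhammer symbols of index `j`; only the factorials run in
  -- the opposite order.
  rw [← Finset.prod_range_reflect]
  refine Finset.prod_congr rfl fun i hi => ?_
  have := Finset.mem_range.1 hi
  congr 3
  omega

theorem constK_mul_prod_pfqCoeff (a : Fin p → ℂ) (b : Fin q → ℂ)
    (h : ∀ m < n, pfqCoeff (fun u => a u - n + 1) (fun v => b v - n + 1) m ≠ 0) (hr : r ≤ n) :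
    constK n r a b *
      ∏ i : Fin r, pfqCoeff (fun u => a u - n + 1) (fun v => b v - n + 1) (n - 1 - (i : ℕ)) =
      1 := by
  rw [constK, ← Finset.Ico_add_one_right_eq_Icc, Finset.prod_Ico_eq_prod_range, Nat.add_sub_cancel,
    Fin.prod_univ_eq_prod_range
      (fun i => pfqCoeff (fun u => a u - n + 1) (fun v => b v - n + 1) (n - 1 - i)),
    ← Finset.prod_mul_distrib]
  refine Finset.prod_eq_one fun i hi => ?_
  have := Finset.mem_range.1 hi
  have h1 := h (n - 1 - i) (by omega)
  rw [show n - (1 + i) = n - 1 - i by omega]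
  have h2 : ((n - 1 - i)! : ℂ) ≠ 0 := by exact_mod_cast Nat.factorial_ne_zero _
  simp only [pfqCoeff] at h1 ⊢
  have h3 := right_ne_zero_of_mul h1
  have h4 : ∏ j, pochhammer (b j - n + 1) (n - 1 - i) ≠ 0 := fun h => h3 (by rw [h, div_zero])
  have h5 : ∏ j, pochhammer (a j - n + 1) (n - 1 - i) ≠ 0 := fun h => h3 (by rw [h, zero_div])
  rw [Finset.prod_inv_distrib]
  field_simp

/-- A vanishing factor at step `i` would force the parameter to equal `n - 1 - i`. As `i ≤ n - 2`,
this lies in `{1, …, n-1}`, excluded for `a`; for `b` it is excluded through `j = n - 1`. -/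
theorem pfqCoeff_ne_zero (a : Fin p → ℂ) (b : Fin q → ℂ)
    (hb : ∀ (i : Fin q) (j : Fin n) (m : ℕ), b i ≠ ((j : ℕ) : ℂ) - (m : ℂ))
    (ha : ∀ (i : Fin p) (l : ℕ), 1 ≤ l → l < n → a i ≠ (l : ℂ)) {m : ℕ} (hm : m < n) :
    pfqCoeff (fun u => a u - n + 1) (fun v => b v - n + 1) m ≠ 0 := by
  refine mul_ne_zero (one_div_ne_zero (by exact_mod_cast Nat.factorial_ne_zero _)) (div_ne_zero
    (Finset.prod_ne_zero_iff.2 fun u _ => pochhammer_ne_zero fun i hi h => ?_)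
    (Finset.prod_ne_zero_iff.2 fun u _ => pochhammer_ne_zero fun i hi h => ?_))
  · refine ha u (n - 1 - i) (by omega) (by omega) ?_
    rw [Nat.cast_sub (by omega), Nat.cast_sub (by omega)]
    push_cast
    linear_combination h
  · refine hb u ⟨n - 1, by omega⟩ i ?_
    simp only
    rw [Nat.cast_sub (by omega)]
    push_cast
    linear_combination h

end blocks

/-! ### From the `n × n` determinant to the `r × r` determinant. -/

section entries

variable {n p q : ℕ} {z₀ : ℂ}

/-- The contour integral attached to a value `w`, to a derivative of order `d` of the scalar
hypergeometric function, and to the power `z ^ (d + l)`. -/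
def contourEntry (a : Fin p → ℂ) (b : Fin q → ℂ) (y : Fin n → ℂ) (γ : Path z₀ z₀) (w : ℂ)
    (d l : ℕ) : ℂ :=
  1 / (2 * Real.pi * Complex.I) * contourIntegral γ fun z =>
    scalarPFQ (fun u => a u - n + 1 + d) (fun v => b v - n + 1 + d) (w * z) *
      z ^ (d + l) / ∏ s, (z - y s)

theorem blockEntry_eq_contourEntry (a : Fin p → ℂ) (b : Fin q → ℂ) (y : Fin n → ℂ)
    (γ : Path z₀ z₀) (w : ℂ) {k i : ℕ} (hi : i ≤ k) (l : ℕ) :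
    blockEntry a b y γ w k i (l + 1) = contourEntry a b y γ w (k - i) l := by
  have h : k - i + (l + 1) - 1 = k - i + l := rfl
  simp only [blockEntry, contourEntry, Nat.cast_sub hi, ← add_sub_assoc, h]

/-- At `w = 0` the scalar function is its constant term 1, so the row depends on neither `a` nor
`b`. -/
theorem IsContour.contourEntry_zero {γ : Path z₀ z₀} (hγ : IsContour γ) {y : Fin n → ℂ}
    (hy : ∀ s, Encloses γ (y s)) (a : Fin p → ℂ) (b : Fin q → ℂ) {d : ℕ} (hd : d < n) (l : ℕ)
    (h : p ≤ q ∨ (∃ (i : Fin p) (m : ℕ), a i = -(m : ℂ)) ∨ p = q + 1) :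
    contourEntry a b y γ 0 d l = completeHomogeneous y (((d + l : ℕ) : ℤ) + 1 - n) := by
  have h1 := hγ.hasSum_scalarPFQ hy (fun u => a u - n + 1 + d) (fun v => b v - n + 1 + d) 0
    (d + l) ?_
  · rw [contourEntry, ← h1.tsum_eq, tsum_eq_single 0]
    · simp [pfqCoeff, pochhammer]
    · intro m hm
      simp [hm]
  · refine h.imp_right (Or.imp ?_ fun h => ⟨h, by simp⟩)
    rintro ⟨u, m, hu⟩
    refine ⟨u, m + (n - 1 - d), ?_⟩
    rw [hu]
    push_cast [Nat.cast_sub (by omega : d ≤ n - 1), Nat.cast_sub (by omega : 1 ≤ n)]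
    ring

/-- The determinant formula with an `n × n` determinant. -/
theorem IsContour.hasSum_matrixPFQTerm {γ : Path z₀ z₀} (hγ : IsContour γ) {y : Fin n → ℂ}
    (hy : ∀ s, Encloses γ (y s)) (a : Fin p → ℂ) (b : Fin q → ℂ) (x : Fin n → ℂ)
    (h : p ≤ q ∨ (∃ (i : Fin p) (m : ℕ), a i = -(m : ℂ)) ∨
      (p = q + 1 ∧ ∀ j t, ‖x j‖ * ‖γ t‖ < 1)) :
    HasSum (fun k => matrixPFQTerm a b x y k *
        ((∏ i : Fin n, pfqCoeff (fun u => a u - n + 1) (fun v => b v - n + 1) (n - 1 - (i : ℕ))) *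
          Matrix.det (Matrix.of fun i j : Fin n => confluentPow x i (n - 1 - (j : ℕ)))))
      ((∏ i : Fin n, pfqCoeff (fun u => a u - n + 1) (fun v => b v - n + 1)
          (confluentOrder x i)) *
        Matrix.det (Matrix.of fun i j : Fin n =>
          contourEntry a b y γ (x i) (confluentOrder x i) j)) := by
  have h1 := hγ.hasSum_confluentPow hy a b x h
  have h2 := MatrixHypergeometric.hasSum_matrixPFQTerm a b x y fun i j => (h1 i j).summable.norm
  simp only [(h1 _ _).tsum_eq] at h2
  have h3 := Matrix.det_mul_column
    (fun i => pfqCoeff (fun u => a u - n + 1) (fun v => b v - n + 1) (confluentOrder x i))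
    (Matrix.of fun i j : Fin n => contourEntry a b y γ (x i) (confluentOrder x i) j)
  rw [← h3]
  exact h2

/-- In the zero row `r + w` the derivative has order `s - 1 - w`, so the entries are
`h_{j-(r+w)}(y)`: 0 before the diagonal and 1 on it. The matrix is block triangular with a
unitriangular lower corner. -/
theorem IsContour.det_contourEntry {r s : ℕ} {γ : Path z₀ z₀} (hγ : IsContour γ)
    {y : Fin (r + s) → ℂ} (hy : ∀ s, Encloses γ (y s)) (a : Fin p → ℂ) (b : Fin q → ℂ)
    {x : Fin (r + s) → ℂ} (hx0 : ∀ w, x (Fin.natAdd r w) = 0)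
    (h : p ≤ q ∨ (∃ (i : Fin p) (m : ℕ), a i = -(m : ℂ)) ∨ p = q + 1) :
    Matrix.det (Matrix.of fun i j : Fin (r + s) =>
        contourEntry a b y γ (x i) (confluentOrder x i) j) =
      Matrix.det (Matrix.of fun i j : Fin r =>
        contourEntry a b y γ (x (Fin.castAdd s i)) (confluentOrder x (Fin.castAdd s i)) j) := by
  set A := Matrix.of fun i j : Fin (r + s) =>
    contourEntry a b y γ (x i) (confluentOrder x i) j with hA
  have hlow : ∀ (w : Fin s) (j : Fin (r + s)), A (Fin.natAdd r w) j =
      completeHomogeneous y ((j : ℤ) - (r + w : ℕ)) := fun w j => by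
    have := w.2
    rw [hA, Matrix.of_apply, hx0, confluentOrder_natAdd hx0,
      hγ.contourEntry_zero hy a b (by omega) j h]
    congr 1
    push_cast [Nat.cast_sub (by omega : (w : ℕ) ≤ s - 1), Nat.cast_sub (by omega : 1 ≤ s)]
    ring
  rw [← Matrix.det_submatrix_equiv_self finSumFinEquiv,
    ← Matrix.fromBlocks_toBlocks (A.submatrix finSumFinEquiv finSumFinEquiv)]
  have h21 : (A.submatrix finSumFinEquiv finSumFinEquiv).toBlocks₂₁ = 0 := by
    ext w v
    simp only [Matrix.toBlocks₂₁, Matrix.submatrix_apply, Matrix.of_apply,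
      finSumFinEquiv_apply_right, finSumFinEquiv_apply_left, Matrix.zero_apply]
    have := v.2
    rw [hlow, completeHomogeneous, if_neg (by simp; omega)]
  have h22 : (A.submatrix finSumFinEquiv finSumFinEquiv).toBlocks₂₂.det = 1 := by
    rw [Matrix.det_of_isUpperTriangular]
    · refine Finset.prod_eq_one fun w _ => ?_
      simp only [Matrix.toBlocks₂₂, Matrix.submatrix_apply, Matrix.of_apply,
        finSumFinEquiv_apply_right]
      rw [hlow]
      simp [completeHomogeneous]
    · intro w w' hw
      have hw : (w' : ℕ) < w := hw
      simp only [Matrix.toBlocks₂₂, Matrix.submatrix_apply, Matrix.of_apply,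
        finSumFinEquiv_apply_right]
      rw [hlow, completeHomogeneous, if_neg (by simp; omega)]
  rw [h21, Matrix.det_fromBlocks_zero₂₁, h22, mul_one]
  rfl

end entries

end MatrixHypergeometric

end

theorem corollary1 {n p q r : ℕ} (hr : r ≤ n)
    (a : Fin p → ℂ) (b : Fin q → ℂ) (x y : Fin n → ℂ)
    -- the multiplicities `k₁, …, k_M ≥ 1` with sum `r`, and the distinct nonzero values
    (c : Composition r) (ξ : Fin c.length → ℂ)
    (hξ : Function.Injective ξ) (hξ0 : ∀ l, ξ l ≠ 0)
    (hx : ∀ j : Fin r, x (Fin.castLE hr j) = ξ (c.index j))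
    (hx0 : ∀ j : Fin n, r ≤ (j : ℕ) → x j = 0)
    -- no denominator of the series vanishes
    (hb : ∀ (i : Fin q) (j : Fin n) (m : ℕ), b i ≠ ((j : ℕ) : ℂ) - (m : ℂ))
    -- no denominator of the constant `K` vanishes
    (ha : ∀ (i : Fin p) (l : ℕ), 1 ≤ l → l < n → a i ≠ (l : ℂ))
    {z₀ : ℂ} (γ : Path z₀ z₀) (hγ : MatrixHypergeometric.IsContour γ)
    (hγy : ∀ s, MatrixHypergeometric.Encloses γ (y s))
    -- the series converge
    (hconv : p ≤ q ∨ (∃ (i : Fin p) (m : ℕ), a i = -(m : ℂ)) ∨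
      (p = q + 1 ∧ (∀ j s, ‖x j‖ * ‖y s‖ < 1) ∧ ∀ j t, ‖x j‖ * ‖γ t‖ < 1)) :
    Summable (MatrixHypergeometric.matrixPFQTerm a b x y) ∧
    MatrixHypergeometric.matrixPFQ a b x y =
      MatrixHypergeometric.constK n r a b /
          (∏ i : Fin c.length, ∏ j ∈ Finset.Ioi i,
            (ξ i - ξ j) ^ (c.blocksFun i * c.blocksFun j)) *
        (∏ l : Fin c.length,
          MatrixHypergeometric.constKMult n (c.blocksFun l) a b /
            ξ l ^ (c.blocksFun l * (n - r))) *
        (MatrixHypergeometric.blockMatrix c a b ξ y γ).det := by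
  classical
  obtain ⟨s, rfl⟩ := Nat.exists_eq_add_of_le hr
  have hx' : ∀ v, x (Fin.castAdd s v) = ξ (c.index v) := hx
  have hx0' : ∀ w, x (Fin.natAdd r w) = 0 := fun w => hx0 _ (by simp)
  have hconv' : p ≤ q ∨ (∃ (i : Fin p) (m : ℕ), a i = -(m : ℂ)) ∨
      (p = q + 1 ∧ ∀ j t, ‖x j‖ * ‖γ t‖ < 1) :=
    hconv.imp_right (Or.imp_right fun h => ⟨h.1, h.2.2⟩)
  have hg := fun m => MatrixHypergeometric.pfqCoeff_ne_zero (m := m) a b hb ha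
  have hsum := hγ.hasSum_matrixPFQTerm hγy a b x hconv'
  rw [hγ.det_contourEntry hγy a b hx0' (hconv.imp_right (Or.imp_right And.left)),
    MatrixHypergeometric.det_confluentPow,
    MatrixHypergeometric.prod_sub_eq_prod_blocks hξ hξ0 hx' hx0', Fin.prod_univ_add,
    Fin.prod_univ_add] at hsum
  have hdet : (Matrix.of fun i j : Fin r => MatrixHypergeometric.contourEntry a b y γ
      (x (Fin.castAdd s i)) (MatrixHypergeometric.confluentOrder x (Fin.castAdd s i)) j) =
      MatrixHypergeometric.blockMatrix c a b ξ y γ := by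
    ext v j
    rw [MatrixHypergeometric.blockMatrix, Matrix.of_apply, Matrix.of_apply,
      MatrixHypergeometric.blockEntry_eq_contourEntry _ _ _ _ _ (c.invEmbedding v).2, hx',
      MatrixHypergeometric.confluentOrder_castAdd hξ hξ0 hx' hx0']
  -- On the zero tail the order equals `n - 1` minus the index, so these coefficients occur on both
  -- sides and cancel.
  have htail : ∀ w : Fin s, MatrixHypergeometric.confluentOrder x (Fin.natAdd r w) =
      r + s - 1 - (Fin.natAdd r w : ℕ) := fun w => by
    rw [MatrixHypergeometric.confluentOrder_natAdd hx0', Fin.val_natAdd]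
    omega
  have hmult : ∏ v : Fin r, MatrixHypergeometric.pfqCoeff
      (fun u => a u - (r + s : ℕ) + 1) (fun v => b v - (r + s : ℕ) + 1)
      (MatrixHypergeometric.confluentOrder x (Fin.castAdd s v)) =
      ∏ l, MatrixHypergeometric.constKMult (r + s) (c.blocksFun l) a b := by
    simp only [MatrixHypergeometric.confluentOrder_castAdd hξ hξ0 hx' hx0']
    rw [MatrixHypergeometric.prod_index_invEmbedding c fun l i => MatrixHypergeometric.pfqCoeff
      (fun u => a u - (r + s : ℕ) + 1) (fun v => b v - (r + s : ℕ) + 1) (c.blocksFun l - (i + 1))]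
    exact Finset.prod_congr rfl fun l _ =>
      MatrixHypergeometric.prod_pfqCoeff_range a b (c.one_le_blocksFun l)
  have hK := MatrixHypergeometric.constK_mul_prod_pfqCoeff (r := r) a b hg hr
  have htail0 : ∏ w : Fin s, MatrixHypergeometric.pfqCoeff
      (fun u => a u - (r + s : ℕ) + 1) (fun v => b v - (r + s : ℕ) + 1)
      (r + s - 1 - (Fin.natAdd r w : ℕ)) ≠ 0 :=
    Finset.prod_ne_zero_iff.2 fun w _ => hg _ (by have := w.2; omega)
  simp only [hdet, hmult, htail, Fin.val_castAdd] at hsum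
  have hV1 : ∏ i : Fin c.length, ∏ j ∈ Finset.Ioi i,
      (ξ i - ξ j) ^ (c.blocksFun i * c.blocksFun j) ≠ 0 :=
    Finset.prod_ne_zero_iff.2 fun i _ => Finset.prod_ne_zero_iff.2 fun j hj =>
      pow_ne_zero _ (sub_ne_zero.2 (hξ.ne (Finset.mem_Ioi.1 hj).ne))
  have hV2 : ∏ l : Fin c.length, ξ l ^ (c.blocksFun l * s) ≠ 0 :=
    Finset.prod_ne_zero_iff.2 fun l _ => pow_ne_zero _ (hξ0 l)
  have hH := right_ne_zero_of_mul_eq_one hK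
  -- The constant multiplying the matrix series is nonzero; dividing by it yields both the
  -- convergence and the value.
  have hW := mul_ne_zero (mul_ne_zero hH htail0) (mul_ne_zero hV1 hV2)
  refine ⟨(summable_mul_right_iff hW).1 hsum.summable, mul_right_cancel₀ hW ?_⟩
  rw [MatrixHypergeometric.matrixPFQ, ← tsum_mul_right, hsum.tsum_eq, Finset.prod_div_distrib,
    Nat.add_sub_cancel_left, eq_div_of_mul_eq hH hK]
  field_simp
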